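/- Let $k$ be a field and let $A$ be a finite-dimensional elementary $k$-algebra (that is, $A/\operatorname{rad}A$ is isomorphic as a $k$-algebra to a finite product of copies of $k$) of finite global dimension. Let $e_1,\dots,e_r$ be a complete set of orthogonal primitive idempotents of $A$, let $A^e=A\otimes_k A^{\mathrm{op}}$ be the enveloping algebra, and let $M$ be a perfect complex of $A$-bimodules, that is, one quasi-isomorphic to a bounded complex of finitely generated projective $A^e$-modules. For a finite-dimensional $A$-bimodule $X$ put $C_X=(\dim_k e_jXe_i)_{1\le i,j\le r}$; in particular $C_A=(\dim_k e_jAe_i)_{i,j}$ is the Cartan matrix of $A$. Put $C_M=\sum_{l\in\mathbb Z}(-1)^l C_{H^l(M)}$. Then $C_A$ is invertible over $\mathbb Z$, and for the dual Coxeter matrix $\Psi_M:=-C_MC_A^{-1}$ the Hochschild homology entropy $$h^{HH_\bullet}(M):=\limsup_{n\to\infty}\frac1n\log\sum_{i\in\mathbb Z}\dim_k H^i\bigl(A\otimes^{L}_{A^e}M^{\otimes^{L}_A n}\bigr)$$ satisfies the Yomdin-type inequality $$h^{HH_\bullet}(M)\ \ge\ \log\rho(\Psi_M).$$ Here $\rho$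 is the spectral radius, i.e. the largest absolute value of a complex eigenvalue, with $\rho=0$ for the empty matrix, and $\log 0=-\infty$. -/

import Mathlib

open CategoryTheory
open scoped TensorProduct

universe u

noncomputable section

namespace HHEntropy

/-! ### Bimodules as modules over the enveloping algebra -/

/-- The enveloping algebra, written so that `A`-bimodules are left modules over it:
`(a ⊗ a'ᵒᵖ) • x = a x a'`. -/
abbrev Env (k A : Type u) [Field k] [Ring A] [Algebra k A] : Type u := A ⊗[k] Aᵐᵒᵖ

section Unbundled

variable (k A : Type u) [Field k] [Ring A] [Algebra k A]
variable (M N : Type u) [AddCommGroup M] [Module k M] [Module (Env k A) M]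
  [IsScalarTower k (Env k A) M]
  [AddCommGroup N] [Module k N] [Module (Env k A) N] [IsScalarTower k (Env k A) N]
variable {M' N' : Type u} [AddCommGroup M'] [Module k M'] [Module (Env k A) M']
  [IsScalarTower k (Env k A) M']
  [AddCommGroup N'] [Module k N'] [Module (Env k A) N'] [IsScalarTower k (Env k A) N']

/-- The outer action of `Aᵉ` on `M ⊗ₖ N`: `(a ⊗ a'ᵒᵖ) • (m ⊗ n) = a m ⊗ n a'`. -/
def outerAction : Env k A →ₐ[k] Module.End k (M ⊗[k] N) :=
  Algebra.TensorProduct.lift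
    (((Module.End.rTensorAlgHom k M N).comp (Algebra.lsmul k k M)).comp
      (Algebra.TensorProduct.includeLeft : A →ₐ[k] Env k A))
    (((Module.End.lTensorAlgHom k N M).comp (Algebra.lsmul k k N)).comp
      (Algebra.TensorProduct.includeRight : Aᵐᵒᵖ →ₐ[k] Env k A))
    (fun a b => by
      change LinearMap.rTensor N (Algebra.lsmul k k M (a ⊗ₜ[k] (1 : Aᵐᵒᵖ) : Env k A)) ∘ₗ
          LinearMap.lTensor M (Algebra.lsmul k k N ((1 : A) ⊗ₜ[k] b : Env k A)) =
        LinearMap.lTensor M (Algebra.lsmul k k N ((1 : A) ⊗ₜ[k] b : Env k A)) ∘ₗ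
          LinearMap.rTensor N (Algebra.lsmul k k M (a ⊗ₜ[k] (1 : Aᵐᵒᵖ) : Env k A))
      rw [LinearMap.rTensor_comp_lTensor, LinearMap.lTensor_comp_rTensor])

theorem outerAction_tmul (a : A) (b : Aᵐᵒᵖ) (m : M) (n : N) :
    outerAction k A M N (a ⊗ₜ[k] b) (m ⊗ₜ[k] n)
      = ((a ⊗ₜ[k] (1 : Aᵐᵒᵖ) : Env k A) • m) ⊗ₜ[k] (((1 : A) ⊗ₜ[k] b : Env k A) • n) := by
  rw [outerAction, Algebra.TensorProduct.lift_tmul]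
  rfl

/-- `M ⊗ₖ N`, regarded as an `A`-bimodule through the outer action. -/
def OuterTensor (k A : Type u) [Field k] [Ring A] [Algebra k A] (M N : Type u)
    [AddCommGroup M] [Module k M] [Module (Env k A) M] [IsScalarTower k (Env k A) M]
    [AddCommGroup N] [Module k N] [Module (Env k A) N] [IsScalarTower k (Env k A) N] : Type u :=
  M ⊗[k] N

instance : AddCommGroup (OuterTensor k A M N) :=
  inferInstanceAs (AddCommGroup (M ⊗[k] N))

instance : Module (Env k A) (OuterTensor k A M N) :=
  Module.compHom (M ⊗[k] N) (outerAction k A M N).toRingHom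

/-- A pure tensor `m ⊗ n`, as an element of the bimodule `M ⊗ₖ N`. -/
def outerMk (m : M) (n : N) : OuterTensor k A M N := m ⊗ₜ[k] n

/-- The sub-bimodule of `M ⊗ₖ N` generated by all `m a ⊗ n - m ⊗ a n`. -/
def balancing : Submodule (Env k A) (OuterTensor k A M N) :=
  Submodule.span (Env k A)
    {z | ∃ (m : M) (a : A) (n : N), z =
      outerMk k A M N (((1 : A) ⊗ₜ[k] MulOpposite.op a : Env k A) • m) n
        - outerMk k A M N m ((a ⊗ₜ[k] (1 : Aᵐᵒᵖ) : Env k A) • n)}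

/-- The tensor product `M ⊗_A N` of two `A`-bimodules, again an `A`-bimodule. -/
abbrev BimodTensor : Type u := OuterTensor k A M N ⧸ balancing k A M N

variable {M N}

/-- `f ⊗ₖ g`, for bimodule maps `f` and `g`. -/
def outerMap (f : M →ₗ[Env k A] M') (g : N →ₗ[Env k A] N') :
    OuterTensor k A M N →ₗ[Env k A] OuterTensor k A M' N' where
  toFun := TensorProduct.map (f.restrictScalars k) (g.restrictScalars k)
  map_add' := map_add _
  map_smul' r z := by
    change TensorProduct.map (f.restrictScalars k) (g.restrictScalars k)
        (outerAction k A M N r z) = outerAction k A M' N' r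
        (TensorProduct.map (f.restrictScalars k) (g.restrictScalars k) z)
    refine LinearMap.congr_fun (f := (TensorProduct.map (f.restrictScalars k)
      (g.restrictScalars k)) ∘ₗ (outerAction k A M N r)) (g := (outerAction k A M' N' r) ∘ₗ
      (TensorProduct.map (f.restrictScalars k) (g.restrictScalars k))) ?_ z
    induction r using TensorProduct.induction_on with
    | zero => simp
    | add x y hx hy =>
      rw [map_add, map_add, LinearMap.comp_add, LinearMap.add_comp, hx, hy]
    | tmul a b =>
      apply TensorProduct.ext'
      intro m n
      simp [outerAction_tmul]

@[simp] theorem outerMap_outerMk (f : M →ₗ[Env k A] M') (g : N →ₗ[Env k A] N') (m : M) (n : N) :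
    outerMap k A f g (outerMk k A M N m n) = outerMk k A M' N' (f m) (g n) := rfl

/-- `f ⊗_A g`, for bimodule maps `f` and `g`. -/
def tensorMap (f : M →ₗ[Env k A] M') (g : N →ₗ[Env k A] N') :
    BimodTensor k A M N →ₗ[Env k A] BimodTensor k A M' N' :=
  Submodule.mapQ _ _ (outerMap k A f g) (by
    refine Submodule.span_le.2 ?_
    rintro _ ⟨m, a, n, rfl⟩
    refine Submodule.subset_span ⟨f m, a, g n, ?_⟩
    simp [map_sub])

/-- The class of `m ⊗ n` in `M ⊗_A N`. -/
def tensorMk (m : M) (n : N) : BimodTensor k A M N :=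
  Submodule.Quotient.mk (outerMk k A M N m n)

@[simp] theorem tensorMap_tensorMk (f : M →ₗ[Env k A] M') (g : N →ₗ[Env k A] N') (m : M) (n : N) :
    tensorMap k A f g (tensorMk k A m n) = tensorMk k A (f m) (g n) := rfl

theorem tensorMk_add_left (m m' : M) (n : N) :
    tensorMk k A (m + m') n = tensorMk k A m n + tensorMk k A m' n :=
  congrArg Submodule.Quotient.mk (TensorProduct.add_tmul m m' n)

theorem tensorMk_add_right (m : M) (n n' : N) :
    tensorMk k A m (n + n') = tensorMk k A m n + tensorMk k A m n' :=
  congrArg Submodule.Quotient.mk (TensorProduct.tmul_add m n n')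

/-- Two bimodule maps out of `M ⊗_A N` agree if they agree on all `m ⊗ n`. -/
theorem tensor_hom_ext {P : Type u} [AddCommGroup P] [Module (Env k A) P]
    {φ ψ : BimodTensor k A M N →ₗ[Env k A] P}
    (h : ∀ m n, φ (tensorMk k A m n) = ψ (tensorMk k A m n)) : φ = ψ := by
  apply LinearMap.ext
  intro z
  obtain ⟨z, rfl⟩ := Submodule.Quotient.mk_surjective _ z
  revert z
  intro (z : M ⊗[k] N)
  induction z using TensorProduct.induction_on with
  | zero => exact (map_zero φ).trans (map_zero ψ).symm
  | tmul m n => exact h m n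
  | add x y hx hy =>
    exact (map_add φ _ _).trans ((congrArg₂ (· + ·) hx hy).trans (map_add ψ _ _).symm)

/-! ### The functor `A ⊗_{Aᵉ} -` -/

variable (M)

/-- The `k`-subspace of `A ⊗ₖ M` spanned by all `b·r ⊗ x - b ⊗ r·x` with
`r = a ⊗ a'ᵒᵖ ∈ Aᵉ`, where `Aᵉ` acts on `A` from the right by `b·(a ⊗ a'ᵒᵖ) = a' b a`. -/
def envBalancing : Submodule k (A ⊗[k] M) :=
  Submodule.span k
    {z | ∃ (b a a' : A) (x : M), z =
      (a' * b * a) ⊗ₜ[k] x - b ⊗ₜ[k] ((a ⊗ₜ[k] MulOpposite.op a' : Env k A) • x)}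

/-- The vector space `A ⊗_{Aᵉ} M`, for an `A`-bimodule `M`. -/
abbrev EnvTensor : Type u := (A ⊗[k] M) ⧸ envBalancing k A M

variable {M}

/-- `A ⊗_{Aᵉ} f`, for a bimodule map `f`. -/
def envTensorMap (f : M →ₗ[Env k A] M') : EnvTensor k A M →ₗ[k] EnvTensor k A M' :=
  Submodule.mapQ _ _ (TensorProduct.map LinearMap.id (f.restrictScalars k)) (by
    refine Submodule.span_le.2 ?_
    rintro _ ⟨b, a, a', x, rfl⟩
    refine Submodule.subset_span ⟨b, a, a', f x, ?_⟩
    simp [map_sub])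

theorem envTensor_hom_ext {P : Type u} [AddCommGroup P] [Module k P]
    {φ ψ : EnvTensor k A M →ₗ[k] P}
    (h : ∀ (b : A) (x : M), φ (Submodule.Quotient.mk (b ⊗ₜ[k] x))
      = ψ (Submodule.Quotient.mk (b ⊗ₜ[k] x))) : φ = ψ := by
  apply Submodule.linearMap_qext
  exact TensorProduct.ext' h

@[simp] theorem envTensorMap_mk (f : M →ₗ[Env k A] M') (b : A) (x : M) :
    envTensorMap k A f (Submodule.Quotient.mk (b ⊗ₜ[k] x))
      = Submodule.Quotient.mk (b ⊗ₜ[k] f x) := rfl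

end Unbundled

/-! ### Functors on categories of bimodules, and complexes -/

section Bundled

open scoped ModuleCat

variable (k A : Type u) [Field k] [Ring A] [Algebra k A]

/-- The category of `A`-bimodules (on which `k` acts centrally). -/
abbrev Bimod : Type (u + 1) := ModuleCat.{u} (Env k A)

/-- The bifunctor `(M, N) ↦ M ⊗_A N` on `A`-bimodules. -/
def tensorBifunctor : Bimod k A ⥤ Bimod k A ⥤ Bimod k A where
  obj M :=
    { obj := fun N => ModuleCat.of (Env k A) (BimodTensor k A M N)
      map := fun g => ModuleCat.ofHom (tensorMap k A LinearMap.id g.hom)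
      map_id := fun N => by
        ext1
        exact tensor_hom_ext k A fun m n => rfl
      map_comp := fun f g => by
        ext1
        exact tensor_hom_ext k A fun m n => rfl }
  map f :=
    { app := fun N => ModuleCat.ofHom (tensorMap k A f.hom LinearMap.id)
      naturality := fun N N' g => by
        ext1
        exact tensor_hom_ext k A fun m n => rfl }
  map_id M := by
    ext N : 2
    ext1
    exact tensor_hom_ext k A fun m n => rfl
  map_comp f g := by
    ext N : 2
    ext1
    exact tensor_hom_ext k A fun m n => rfl

instance : (tensorBifunctor k A).Additive where
  map_add {M M' f g} := by
    ext N : 2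
    ext1
    exact tensor_hom_ext k A fun m n => tensorMk_add_left k A (f.hom m) (g.hom m) n

instance (M : Bimod k A) : ((tensorBifunctor k A).obj M).Additive where
  map_add {N N' f g} := by
    ext1
    exact tensor_hom_ext k A fun m n => tensorMk_add_right k A m (f.hom n) (g.hom n)

/-- The functor `A ⊗_{Aᵉ} -` from `A`-bimodules to vector spaces. -/
def envTensorFunctor : Bimod k A ⥤ ModuleCat.{u} k where
  obj M := ModuleCat.of k (EnvTensor k A M)
  map f := ModuleCat.ofHom (envTensorMap k A f.hom)
  map_id M := by
    ext1
    exact envTensor_hom_ext k A fun b x => rfl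
  map_comp f g := by
    ext1
    exact envTensor_hom_ext k A fun b x => rfl

instance : (envTensorFunctor k A).Additive where
  map_add {M M' f g} := by
    ext1
    exact envTensor_hom_ext k A fun b x =>
      congrArg Submodule.Quotient.mk (TensorProduct.tmul_add b (f.hom x) (g.hom x))

variable {k A}

/-- The tensor product over `A` of two complexes of `A`-bimodules (the total complex). -/
def tensorComplex (K L : CochainComplex (Bimod k A) ℤ) : CochainComplex (Bimod k A) ℤ :=
  CochainComplex.mapBifunctor K L (tensorBifunctor k A)

/-- `tensorPowSucc P n` is the `(n + 1)`-st tensor power `P ⊗_A ⋯ ⊗_A P` of a complex. -/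
def tensorPowSucc (P : CochainComplex (Bimod k A) ℤ) : ℕ → CochainComplex (Bimod k A) ℤ
  | 0 => P
  | n + 1 => tensorComplex (tensorPowSucc P n) P

/-- The complex `A ⊗_{Aᵉ} K` of vector spaces. -/
def envTensorComplex (K : CochainComplex (Bimod k A) ℤ) : CochainComplex (ModuleCat.{u} k) ℤ :=
  ((envTensorFunctor k A).mapHomologicalComplex (ComplexShape.up ℤ)).obj K

/-- The dimension of the total cohomology of a complex of vector spaces. -/
def tdim (V : CochainComplex (ModuleCat.{u} k) ℤ) : ENNReal :=
  ∑' i : ℤ, ((Module.rank k (V.homology i : ModuleCat.{u} k)).toENat : ENNReal)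

/-- A bounded complex `P` of finitely generated projective `A`-bimodules with a quasi-isomorphism
`P ⟶ M`. The complex `M` is perfect if and only if it has such a resolution. -/
structure PerfectResolution (M : CochainComplex (Bimod k A) ℤ) where
  P : CochainComplex (Bimod k A) ℤ
  bounded : {i : ℤ | ¬ Limits.IsZero (P.X i)}.Finite
  finite : ∀ i, Module.Finite (Env k A) (P.X i)
  projective : ∀ i, Module.Projective (Env k A) (P.X i)
  π : P ⟶ M
  quasiIso : QuasiIso π

/-- The Hochschild homology entropy
`limsup_{n → ∞} (1/n) log tdim (A ⊗ᴸ_{Aᵉ} (M ⊗ᴸ_A ⋯ ⊗ᴸ_A M))` (with `n ≥ 1` factors `M`) of a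
perfect bimodule complex `M`, computed from a resolution `P` of `M`: the terms of `P` are projective
as bimodules, hence on each side, so `P ⊗_A ⋯ ⊗_A P` is the derived tensor power of `M`; it is again
a bounded complex of projective bimodules, so `A ⊗_{Aᵉ} -` of it is the derived tensor product. -/
def PerfectResolution.hhEntropy {M : CochainComplex (Bimod k A) ℤ} (R : PerfectResolution M) :
    EReal :=
  Filter.limsup
    (fun n : ℕ =>
      ENNReal.log (tdim (envTensorComplex (tensorPowSucc R.P n))) / ((n + 1 : ℕ) : EReal))
    Filter.atTop

/-! ### Cartan and Coxeter matrices -/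

/-- The Cartan matrix of a finite-dimensional bimodule `X`: the `(i, j)` entry is
`dim (e_j X e_i)`, where `e_j X e_i` is the image of `x ↦ e_j x e_i`. -/
def cartanMatrix {r : ℕ} (e : Fin r → A) (X : Bimod k A) : Matrix (Fin r) (Fin r) ℤ :=
  Matrix.of fun i j => (Module.finrank k (LinearMap.range
    (Algebra.lsmul k k X (e j ⊗ₜ[k] MulOpposite.op (e i) : Env k A))) : ℤ)

/-- The Cartan matrix `∑ₗ (-1)ˡ C_{Hˡ(M)}` of a bimodule complex `M` of finite-dimensional total
cohomology. -/
def cartanMatrixComplex {r : ℕ} (e : Fin r → A) (M : CochainComplex (Bimod k A) ℤ) :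
    Matrix (Fin r) (Fin r) ℤ :=
  ∑ᶠ l : ℤ, (l.negOnePow : ℤ) • cartanMatrix e (M.homology l)

variable (k A) in
/-- `A` as a bimodule over itself, `(a ⊗ a'ᵒᵖ) • x = a x a'`. -/
def regularBimodule : Bimod k A :=
  letI : Module (Env k A) A := TensorProduct.Algebra.module
  ModuleCat.of (Env k A) A

variable (k) in
/-- The Cartan matrix of the algebra `A`. -/
def cartanMatrixAlgebra {r : ℕ} (e : Fin r → A) : Matrix (Fin r) (Fin r) ℤ :=
  cartanMatrix e (regularBimodule k A)

/-- The dual Coxeter matrix `-C_M C_A⁻¹` of a bimodule complex `M`. -/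
def dualCoxeterMatrix {r : ℕ} (e : Fin r → A) (M : CochainComplex (Bimod k A) ℤ) :
    Matrix (Fin r) (Fin r) ℤ :=
  -(cartanMatrixComplex e M * (cartanMatrixAlgebra k e)⁻¹)

/-- The spectral radius of an integer matrix: the largest modulus of a complex eigenvalue
(`0` for the empty matrix). -/
def matrixSpectralRadius {r : ℕ} (C : Matrix (Fin r) (Fin r) ℤ) : ENNReal :=
  spectralRadius ℂ (C.map (Int.cast : ℤ → ℂ))

end Bundled

/-! ### Classes of algebras -/

/-- The algebra `A` is elementary: `A / rad A` is a finite product of copies of `k`. -/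
def IsElementary (k A : Type u) [Field k] [Ring A] [Algebra k A] : Prop :=
  ∃ r : ℕ, Nonempty ((A ⧸ Ring.jacobson A) ≃ₐ[k] (Fin r → k))

/-- The ring `A` has finite (right) global dimension: the projective dimensions of right
`A`-modules are bounded. -/
def FiniteGlobalDimension (A : Type u) [Ring A] : Prop :=
  ∃ d : ℕ, ∀ X : ModuleCat.{u} Aᵐᵒᵖ, HasProjectiveDimensionLE X d

/-- A primitive idempotent: a nonzero idempotent that is not a sum of two nonzero orthogonal
idempotents. -/
def IsPrimitiveIdempotent {A : Type u} [Ring A] (e : A) : Prop :=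
  IsIdempotentElem e ∧ e ≠ 0 ∧ ∀ f g : A, IsIdempotentElem f → IsIdempotentElem g →
    f * g = 0 → g * f = 0 → f + g = e → f = 0 ∨ g = 0

end HHEntropy

end

noncomputable section

namespace HHEntropy

/-! ### Linear algebra -/

section LinearAlgebra

variable {k : Type*} [Field k]

/-! The total dimension of the cohomology of a complex of vector spaces is at least the absolute
value of its Euler characteristic (`natAbs_altSum_le_tdim`). For the complex computing the
Hochschild homology of an `n`-fold derived tensor power of `M`, with `n ≥ 2`, this Euler
characteristic is the trace of `(C_M C_A⁻¹) ^ n`. The entropy therefore dominates the exponential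
growth rate of the traces of the powers of the dual Coxeter matrix, whose sign is lost in the
absolute value.

The trace formula is checked on projective bimodules. Since `A` is elementary, `Aᵉ` is split basic
(`isSplitBasic_env`), and a finitely generated projective `Q` behaves under additive functors like a
sum of copies of `A e_c ⊗ e_d A`, counted by a matrix `N` (`IsSplitBasic.exists_multiplicity`).
Direct computation on these summands (`exists_multiplicityMatrix`) gives `C_Q = C_A N C_A`, `C_{K ⊗
Q} = C_A N C_K` and `dim A ⊗_{Aᵉ} (K ⊗_A Q) = tr (N C_K)`. As `C_A` is invertible, `N` can be
eliminated in favour of `C_Q`. Alternating sums over the total complex carry the formulas over to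
complexes (`eulerMatrix_tensorComplex`), and induction handles powers. Exactness of `X ↦ e_j X e_i`
identifies the alternating sum over the terms of a resolution with that over cohomology
(`cartanMatrixComplex_eq_eulerMatrix`).

Invertibility of `C_A` comes from finite global dimension: a simple module has a finite resolution
by finitely generated projectives, so its dimension vector, a unit vector, is an integral
combination of the columns of `C_A`.

Finally, traces of powers are power sums of the eigenvalues with positive multiplicities. By
recurrence on a torus there are arbitrarily large `n` for which the `n`-th powers of all nonzero
eigenvalues point nearly in the positive direction; then nothing cancels and the trace is at least
`ρ ^ n / 2` (`frequently_pow_le_norm_trace`). -/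

theorem finrank_range_comp_eq_of_comp_comp {V W : Type*} [AddCommGroup V] [Module k V]
    [AddCommGroup W] [Module k W] [FiniteDimensional k V] [FiniteDimensional k W]
    (f : V →ₗ[k] W) (g : W →ₗ[k] V) (hf : f ∘ₗ g ∘ₗ f = f) :
    Module.finrank k (LinearMap.range (f ∘ₗ g)) = Module.finrank k (LinearMap.range (g ∘ₗ f)) := by
  -- Both composites are idempotent, and `f` and `g` restrict to inverse bijections between their
  -- ranges.
  apply le_antisymm
  · have h : LinearMap.range (f ∘ₗ g) ≤ (LinearMap.range (g ∘ₗ f)).map f := by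
      rintro _ ⟨x, rfl⟩
      exact ⟨g (f (g x)), ⟨g x, rfl⟩, LinearMap.congr_fun hf (g x)⟩
    exact (Submodule.finrank_mono h).trans (Submodule.finrank_map_le _ _)
  · have h : LinearMap.range (g ∘ₗ f) ≤ (LinearMap.range (f ∘ₗ g)).map g := by
      rintro _ ⟨x, rfl⟩
      exact ⟨f (g (f x)), ⟨f x, rfl⟩, congrArg g (LinearMap.congr_fun hf x)⟩
    exact (Submodule.finrank_mono h).trans (Submodule.finrank_map_le _ _)

/-- The linear equivalence of a module with the product of the members of a finite direct sum
decomposition of it. -/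
def equivPiOfDecomposition {ι : Type*} [Fintype ι] [DecidableEq ι] {V : Type*} [AddCommGroup V]
    [Module k V] {W : ι → Type*} [∀ i, AddCommGroup (W i)] [∀ i, Module k (W i)]
    (inc : ∀ i, W i →ₗ[k] V) (proj : ∀ i, V →ₗ[k] W i)
    (h_same : ∀ i w, proj i (inc i w) = w) (h_ne : ∀ i j w, i ≠ j → proj j (inc i w) = 0)
    (h_total : ∀ v, ∑ i, inc i (proj i v) = v) : V ≃ₗ[k] (∀ i, W i) where
  toFun v i := proj i v
  map_add' x y := by ext i; simp
  map_smul' c x := by ext i; simp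
  invFun w := ∑ i, inc i (w i)
  left_inv v := h_total v
  right_inv w := by
    ext j
    change proj j (∑ i, inc i (w i)) = w j
    rw [map_sum, Finset.sum_eq_single j]
    · exact h_same j _
    · exact fun i _ hij => h_ne i j _ hij
    · simp

end LinearAlgebra

/-! ### Additive functors and finite direct sums -/

section AdditiveFunctor

variable {k : Type u} [Field k] {𝒞 : Type*} [Category 𝒞] [Preadditive 𝒞]
  (F : 𝒞 ⥤ ModuleCat.{u} k) [F.Additive]

/-- An additive functor to vector spaces turns finite direct sum decompositions into products. -/
def mapDecompositionEquiv {ι : Type*} [Fintype ι] [DecidableEq ι] {X : 𝒞} {Y : ι → 𝒞}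
    (inc : ∀ i, Y i ⟶ X) (proj : ∀ i, X ⟶ Y i) (h_same : ∀ i, inc i ≫ proj i = 𝟙 _)
    (h_ne : ∀ i j, i ≠ j → inc i ≫ proj j = 0) (h_total : ∑ i, proj i ≫ inc i = 𝟙 X) :
    F.obj X ≃ₗ[k] (∀ i, F.obj (Y i)) :=
  equivPiOfDecomposition (fun i => (F.map (inc i)).hom) (fun i => (F.map (proj i)).hom)
    (fun i w => by
      have := congrArg (fun φ => (F.map φ).hom w) (h_same i)
      simpa using this)
    (fun i j w hij => by
      have := congrArg (fun φ => (F.map φ).hom w) (h_ne i j hij)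
      simpa using this)
    (fun v => by
      have := congrArg (fun φ => (F.map φ).hom v) h_total
      simpa [Functor.map_sum, ModuleCat.hom_sum] using this)

end AdditiveFunctor

/-! ### Alternating sums and Euler characteristics -/

section Euler

/-- The alternating sum of a finitely supported family of integers. -/
def altSum (f : ℤ → ℤ) : ℤ := ∑ᶠ l : ℤ, (l.negOnePow : ℤ) * f l

/-- A `finsum` with infinite support is zero by convention, so alternating sums are evaluated
through a finite set outside which the family vanishes. -/
theorem altSum_eq_sum {f : ℤ → ℤ} (s : Finset ℤ) (hs : ∀ l ∉ s, f l = 0) :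
    altSum f = ∑ l ∈ s, (l.negOnePow : ℤ) * f l := by
  refine finsum_eq_sum_of_support_subset _ fun l hl => ?_
  by_contra h
  exact hl (by simp [hs l h])

variable {k : Type u} [Field k]

theorem finrank_homology (S : ShortComplex (ModuleCat.{u} k)) [FiniteDimensional k S.X₁]
    [FiniteDimensional k S.X₂] [FiniteDimensional k S.X₃] :
    FiniteDimensional k S.homology ∧
      (Module.finrank k S.homology : ℤ) = Module.finrank k S.X₂
        - Module.finrank k (LinearMap.range S.f.hom)
        - Module.finrank k (LinearMap.range S.g.hom) := by
  have eq : S.homology ≃ₗ[k] (LinearMap.ker S.g.hom ⧸ LinearMap.range S.moduleCatToCycles) :=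
    S.moduleCatHomologyIso.toLinearEquiv
  refine ⟨Module.Finite.equiv eq.symm, ?_⟩
  have h0 := eq.finrank_eq
  have h1 := LinearMap.finrank_range_add_finrank_ker S.g.hom
  have h2 := Submodule.finrank_quotient_add_finrank (LinearMap.range S.moduleCatToCycles)
  have h3 : Module.finrank k (LinearMap.range S.moduleCatToCycles)
      = Module.finrank k (LinearMap.range S.f.hom) := by
    have : LinearMap.range S.f.hom = (LinearMap.range S.moduleCatToCycles).map
        (LinearMap.ker S.g.hom).subtype := by
      rw [← LinearMap.range_comp]
      rfl
    rw [this]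
    exact (LinearEquiv.finrank_eq (Submodule.equivMapOfInjective _
      (LinearMap.ker S.g.hom).injective_subtype _))
  omega

variable (V : CochainComplex (ModuleCat.{u} k) ℤ)

theorem finrank_cochainComplex_homology (hV : ∀ i, FiniteDimensional k (V.X i)) (i : ℤ) :
    FiniteDimensional k (V.homology i) ∧
      (Module.finrank k (V.homology i) : ℤ) = Module.finrank k (V.X i)
        - Module.finrank k (LinearMap.range (V.d (i - 1) i).hom)
        - Module.finrank k (LinearMap.range (V.d i (i + 1)).hom) := by
  have e : V.homology i ≅ (V.sc' (i - 1) i (i + 1)).homology :=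
    ShortComplex.homologyMapIso (V.isoSc' (i - 1) i (i + 1) (by simp) (by simp))
  have : FiniteDimensional k (V.sc' (i - 1) i (i + 1)).X₁ := hV _
  have : FiniteDimensional k (V.sc' (i - 1) i (i + 1)).X₂ := hV _
  have : FiniteDimensional k (V.sc' (i - 1) i (i + 1)).X₃ := hV _
  obtain ⟨h1, h2⟩ := finrank_homology (V.sc' (i - 1) i (i + 1))
  exact ⟨Module.Finite.equiv e.symm.toLinearEquiv, e.toLinearEquiv.finrank_eq ▸ h2⟩

theorem finrank_eq_zero_of_isZero {X : ModuleCat.{u} k} (h : Limits.IsZero X) :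
    Module.finrank k X = 0 :=
  have := ModuleCat.subsingleton_of_isZero h
  Module.finrank_zero_of_subsingleton

/-- The Euler characteristic of a bounded complex of finite-dimensional vector spaces is that of
its cohomology. -/
theorem altSum_finrank_homology (hV : ∀ i, FiniteDimensional k (V.X i))
    (hb : {i : ℤ | ¬ Limits.IsZero (V.X i)}.Finite) :
    altSum (fun i => Module.finrank k (V.homology i))
      = altSum (fun i => Module.finrank k (V.X i)) := by
  set s : Finset ℤ := hb.toFinset
  have hs : ∀ i ∉ s, Module.finrank k (V.X i) = 0 := fun i hi =>
    finrank_eq_zero_of_isZero (by simpa [s] using hi)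
  -- With `b i` the rank of the differential into degree `i`, the cohomology in degree `l` has
  -- dimension `dim V.X l - b l - b (l + 1)`; the two rank terms cancel after a shift, which changes
  -- the sign.
  set b : ℤ → ℤ := fun i => Module.finrank k (LinearMap.range (V.d (i - 1) i).hom)
  have hb0 : ∀ i ∉ s, b i = 0 := fun i hi => by
    have := (Submodule.finrank_le (LinearMap.range (V.d (i - 1) i).hom)).trans (hs i hi).le
    simp only [b]; omega
  have hbs : (Function.support fun l : ℤ => (l.negOnePow : ℤ) * b l).Finite :=
    s.finite_toSet.subset fun l hl => by
      by_contra h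
      exact hl (by simp [hb0 l h])
  have hXs : (Function.support fun l : ℤ => (l.negOnePow : ℤ) * Module.finrank k (V.X l)).Finite :=
    s.finite_toSet.subset fun l hl => by
      by_contra h
      exact hl (by simp [hs l h])
  have hshift : ∑ᶠ l : ℤ, (l.negOnePow : ℤ) * b (l + 1) = - ∑ᶠ l : ℤ, (l.negOnePow : ℤ) * b l := by
    rw [← finsum_comp_equiv (Equiv.addRight (1 : ℤ)) (f := fun l : ℤ => (l.negOnePow : ℤ) * b l),
      ← finsum_neg_distrib]
    simp [Int.negOnePow_succ]
  have hbs' : (Function.support fun l : ℤ => (l.negOnePow : ℤ) * b (l + 1)).Finite := by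
    refine (hbs.preimage (f := fun l : ℤ => l + 1) (add_left_injective 1).injOn).subset ?_
    intro l hl
    simpa [Int.negOnePow_succ] using hl
  unfold altSum
  have key : ∀ l : ℤ, (l.negOnePow : ℤ) * (Module.finrank k (V.homology l) : ℤ)
      = ((l.negOnePow : ℤ) * Module.finrank k (V.X l) - (l.negOnePow : ℤ) * b l)
        - (l.negOnePow : ℤ) * b (l + 1) := by
    intro l
    rw [(finrank_cochainComplex_homology V hV l).2]
    simp only [b]
    rw [add_sub_cancel_right]
    ring
  simp_rw [key]
  rw [finsum_sub_distrib _ hbs', finsum_sub_distrib hXs hbs, hshift]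
  · ring
  · exact (hXs.union hbs).subset fun l hl => by
      by_contra h
      simp only [Set.mem_union, Function.mem_support, not_or, not_not] at h
      exact hl (by simp only [h.1, h.2, sub_self])

/-- The total cohomology is at least as large as the Euler characteristic. -/
theorem natAbs_altSum_le_tdim (hV : ∀ i, FiniteDimensional k (V.X i))
    (hb : {i : ℤ | ¬ Limits.IsZero (V.X i)}.Finite) :
    ((altSum fun i => Module.finrank k (V.X i)).natAbs : ENNReal) ≤ tdim V := by
  set s : Finset ℤ := hb.toFinset
  have hs : ∀ i ∉ s, Module.finrank k (V.homology i) = 0 := fun i hi => by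
    have h1 := finrank_eq_zero_of_isZero (X := V.X i) (by simpa [s] using hi)
    have := (finrank_cochainComplex_homology V hV i).2
    omega
  rw [← altSum_finrank_homology V hV hb, altSum_eq_sum s (fun l hl => by simp [hs l hl])]
  calc ((∑ l ∈ s, (l.negOnePow : ℤ) * (Module.finrank k (V.homology l) : ℤ)).natAbs : ENNReal)
      ≤ ((∑ l ∈ s, Module.finrank k (V.homology l) : ℕ) : ENNReal) := by
        norm_cast
        refine (Int.natAbs_sum_le _ _).trans (Finset.sum_le_sum fun l _ => ?_)
        simp [Int.natAbs_mul]
    _ = ∑ l ∈ s, ((Module.rank k (V.homology l)).toENat : ENNReal) := by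
        push_cast
        refine Finset.sum_congr rfl fun l _ => ?_
        have := (finrank_cochainComplex_homology V hV l).1
        rw [← Module.finrank_eq_rank, Cardinal.toENat_nat]
        rfl
    _ ≤ tdim V := ENNReal.sum_le_tsum s

end Euler

/-! ### Projective modules over split basic algebras -/

section SplitBasic

/-- The algebra `B` is split basic: modulo its radical it is a product of copies of `k` (by way of
`π`), and `ε` is a complete family of orthogonal idempotents lifting the standard ones. -/
structure IsSplitBasic {k B ι : Type*} [Field k] [Ring B] [Algebra k B] [Fintype ι]
    [DecidableEq ι] (ε : ι → B) (π : B →ₐ[k] (ι → k)) : Prop where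
  complete : CompleteOrthogonalIdempotents ε
  map_single : ∀ i, π (ε i) = Pi.single i 1
  mem_jacobson : ∀ b, π b = 0 → b ∈ Ring.jacobson B

/-- Membership in the radical gives left inverses. A left inverse `z` of `1 + x` equals `1 - z x`,
so it has a left inverse itself, which must be `1 + x`; hence `z` is also a right inverse. -/
theorem exists_mul_eq_one_of_mem_jacobson {B : Type*} [Ring B] {x : B} (hx : x ∈ Ring.jacobson B) :
    ∃ v, (1 + x) * v = 1 := by
  have left : ∀ {x : B}, x ∈ Ring.jacobson B → ∃ z, z * (1 + x) = 1 := by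
    intro x hx
    rw [← Ideal.jacobson_bot, Ideal.mem_jacobson_iff] at hx
    obtain ⟨z, hz⟩ := hx 1
    refine ⟨z, ?_⟩
    rw [Submodule.mem_bot, mul_one, sub_eq_zero] at hz
    rw [mul_add, mul_one, add_comm, hz]
  obtain ⟨z, hz⟩ := left hx
  obtain ⟨w, hw⟩ := left (x := -(z * x)) (neg_mem ((Ring.jacobson B).mul_mem_left z hx))
  have hz' : 1 + -(z * x) = z := by
    rw [mul_add, mul_one] at hz
    rw [← hz]; abel
  rw [hz'] at hw
  have : w = 1 + x := by
    calc w = w * (z * (1 + x)) := by rw [hz, mul_one]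
      _ = 1 + x := by rw [← mul_assoc, hw, one_mul]
  exact ⟨z, this ▸ hw⟩

namespace IsSplitBasic

variable {k B ι : Type*} [Field k] [Ring B] [Algebra k B] [Fintype ι] [DecidableEq ι]
  {ε : ι → B} {π : B →ₐ[k] (ι → k)} (h : IsSplitBasic ε π)
include h

theorem ne_zero (i : ι) : ε i ≠ 0 := by
  intro h0
  have := h.map_single i
  rw [h0, map_zero] at this
  simpa using congrFun this i

/-- The corner at `ε i` is local with residue field `k`: modulo the radical `y` is `c • ε i` with `c
≠ 0`, so `c⁻¹ • y` is `ε i` times a right invertible element `1 + x`. -/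
theorem exists_mul_eq_idempotent {i : ι} {y : B} (hy : ε i * y * ε i = y) (hy0 : π y ≠ 0) :
    ∃ z, y * z = ε i := by
  have hid := h.complete.idem i
  have hπ : π y = (π y i) • (Pi.single i 1 : ι → k) := by
    conv_lhs => rw [← hy]
    rw [map_mul, map_mul, h.map_single]
    ext j
    by_cases hj : j = i
    · subst hj; simp
    · simp [hj]
  have hc : π y i ≠ 0 := fun hc => hy0 (by rw [hπ, hc, zero_smul])
  have hx : ((π y i)⁻¹ • y - ε i) ∈ Ring.jacobson B := by
    apply h.mem_jacobson
    rw [map_sub, map_smul, hπ, h.map_single, smul_smul]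
    simp [hc]
  obtain ⟨v, hv⟩ := exists_mul_eq_one_of_mem_jacobson hx
  refine ⟨(π y i)⁻¹ • v, ?_⟩
  have h1 : ε i * (1 + ((π y i)⁻¹ • y - ε i)) = (π y i)⁻¹ • y := by
    have : ε i * y = y := by
      rw [← hy, ← mul_assoc, ← mul_assoc, hid.eq]
    rw [mul_add, mul_one, mul_sub, hid.eq, mul_smul_comm, this]
    abel
  calc y * ((π y i)⁻¹ • v) = ((π y i)⁻¹ • y) * v := by rw [mul_smul_comm, smul_mul_assoc]
    _ = ε i := by rw [← h1, mul_assoc, hv, mul_one]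

/-- A nonzero finitely generated projective module has some `B εᵢ` as a direct summand. -/
theorem exists_dual_pair (P : Type*) [AddCommGroup P] [Module B P] [Module.Finite B P]
    [Module.Projective B P] [Nontrivial P] :
    ∃ (i : ι) (p : P) (ψ : P →ₗ[B] B), ε i • p = p ∧ ψ p = ε i := by
  -- By Nakayama the radical of `P` is proper, and by completeness some `ε i • q` lies outside it.
  have hlt := Submodule.jacobson_smul_lt_top (R := B) (M := P) ⊤
  obtain ⟨q, -, hq⟩ := SetLike.exists_of_lt hlt
  obtain ⟨i, hi⟩ : ∃ i, ε i • q ∉ Ring.jacobson B • (⊤ : Submodule B P) := by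
    by_contra hcon
    push Not at hcon
    apply hq
    rw [← one_smul B q, ← h.complete.complete, Finset.sum_smul]
    exact Submodule.sum_mem _ fun i _ => hcon i
  have hid := h.complete.idem i
  -- `s` embeds `P` as a summand of a free module. Were all coordinates of `s (ε i • q)` in the
  -- radical, `ε i • q` would lie in the radical of `P`.
  obtain ⟨s, hs⟩ := Module.projective_def.1 (inferInstance : Module.Projective B P)
  obtain ⟨x, hx⟩ : ∃ x, π (s (ε i • q) x) ≠ 0 := by
    by_contra hcon
    push Not at hcon
    apply hi
    rw [← hs (ε i • q), Finsupp.linearCombination_apply]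
    exact Submodule.sum_mem _ fun x _ =>
      Submodule.smul_mem_smul (h.mem_jacobson _ (hcon x)) Submodule.mem_top
  set a : B := s (ε i • q) x with ha
  have ha' : ε i * a = a := by
    have : ε i • s (ε i • q) = s (ε i • q) := by rw [← map_smul, smul_smul, hid.eq]
    calc ε i * a = (ε i • s (ε i • q)) x := by simp [ha]
      _ = a := by rw [this]
  have hπa : π (a * ε i) ≠ 0 := by
    have h1 : π a = π (a * ε i) := by
      rw [← ha', map_mul, map_mul, map_mul, h.map_single]
      ext j
      by_cases hj : j = i
      · subst hj; simp
      · simp [hj]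
    rwa [← h1]
  obtain ⟨z, hz⟩ := h.exists_mul_eq_idempotent (i := i) (y := a * ε i)
    (by rw [← mul_assoc, ha', mul_assoc, hid.eq]) hπa
  -- The functional is the `x`-th coordinate followed by right multiplication by `ε i * z`, which
  -- takes `a` to `a * ε i * z = ε i`.
  refine ⟨i, ε i • q,
    (LinearMap.toSpanSingleton B B (ε i * z)) ∘ₗ (Finsupp.lapply x) ∘ₗ s, ?_, ?_⟩
  · rw [smul_smul, hid.eq]
  · simp only [LinearMap.comp_apply, Finsupp.lapply_apply, LinearMap.toSpanSingleton_apply,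
      smul_eq_mul]
    rw [← ha, ← mul_assoc, hz]

end IsSplitBasic

end SplitBasic

/-! ### Multiplicities of indecomposable projectives -/

section Multiplicity

variable {k B : Type u} {ι : Type*} [Field k] [Ring B] [Algebra k B]

/-- Right multiplication by `b`, as an endomorphism of the left module `B`. -/
def rightMul (b : B) : ModuleCat.of B B ⟶ ModuleCat.of B B :=
  ModuleCat.ofHom (LinearMap.toSpanSingleton B B b)

/-- If `j q` and `q j` are complementary to `f g`, then `F` splits accordingly. -/
theorem finrank_map_of_splitting {𝒞 : Type*} [Category 𝒞] [Preadditive 𝒞]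
    (F : 𝒞 ⥤ ModuleCat.{u} k) [F.Additive] {X Y Z : 𝒞} (f : Y ⟶ X) (g : X ⟶ Y) (j : Z ⟶ X)
    (q : X ⟶ Z) (hf : f ≫ g ≫ f = f) (hj : j ≫ q = 𝟙 Z) (hsum : g ≫ f + q ≫ j = 𝟙 X)
    (hY : FiniteDimensional k (F.obj Y)) (hZ : FiniteDimensional k (F.obj Z)) :
    FiniteDimensional k (F.obj X) ∧ Module.finrank k (F.obj X) =
      Module.finrank k (LinearMap.range (F.map (f ≫ g)).hom) + Module.finrank k (F.obj Z) := by
  have hfF : (F.map f).hom ∘ₗ (F.map g).hom ∘ₗ (F.map f).hom = (F.map f).hom := by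
    rw [← ModuleCat.hom_comp, ← ModuleCat.hom_comp, ← F.map_comp, ← F.map_comp, Category.assoc, hf]
  have hjF : (F.map q).hom ∘ₗ (F.map j).hom = LinearMap.id := by
    rw [← ModuleCat.hom_comp, ← F.map_comp, hj, F.map_id, ModuleCat.hom_id]
  have hsumF : (F.map f).hom ∘ₗ (F.map g).hom + (F.map j).hom ∘ₗ (F.map q).hom
      = LinearMap.id := by
    rw [← ModuleCat.hom_comp, ← ModuleCat.hom_comp, ← F.map_comp, ← F.map_comp,
      ← ModuleCat.hom_add, ← F.map_add, hsum, F.map_id, ModuleCat.hom_id]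
  have hX : FiniteDimensional k (F.obj X) := by
    refine Module.Finite.of_surjective ((F.map f).hom.coprod (F.map j).hom) fun x => ?_
    exact ⟨((F.map g).hom x, (F.map q).hom x), LinearMap.congr_fun hsumF x⟩
  refine ⟨hX, ?_⟩
  -- The idempotent on `F Y` is traded for the one on `F X` of the same rank, whose kernel is the
  -- image of `F Z`; rank-nullity finishes.
  rw [F.map_comp, ModuleCat.hom_comp, ← finrank_range_comp_eq_of_comp_comp _ _ hfF]
  have hker : LinearMap.ker ((F.map f).hom ∘ₗ (F.map g).hom) = LinearMap.range (F.map j).hom := by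
    apply le_antisymm
    · intro x hx
      have := LinearMap.congr_fun hsumF x
      rw [LinearMap.add_apply, LinearMap.mem_ker.1 hx, zero_add] at this
      exact ⟨_, this⟩
    · rintro _ ⟨z, rfl⟩
      have := LinearMap.congr_fun hsumF ((F.map j).hom z)
      have hz : (F.map q).hom ((F.map j).hom z) = z := LinearMap.congr_fun hjF z
      rw [LinearMap.add_apply, LinearMap.comp_apply (F.map j).hom, hz] at this
      simpa using this
  have hinj : Function.Injective (F.map j).hom :=
    Function.LeftInverse.injective (g := (F.map q).hom) (LinearMap.congr_fun hjF)
  have hrank := LinearMap.finrank_range_add_finrank_ker ((F.map f).hom ∘ₗ (F.map g).hom)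
  rw [hker, LinearMap.finrank_range_of_inj hinj] at hrank
  exact hrank.symm

/-- A finitely generated projective module has multiplicities that determine the dimension of its
image under every additive functor to vector spaces. -/
theorem IsSplitBasic.exists_multiplicity [Fintype ι] [DecidableEq ι] [FiniteDimensional k B]
    {ε : ι → B} {π : B →ₐ[k] (ι → k)} (h : IsSplitBasic ε π)
    (P : Type u) [AddCommGroup P] [Module B P] [Module.Finite B P] [Module.Projective B P] :
    ∃ N : ι → ℕ, ∀ (F : ModuleCat.{u} B ⥤ ModuleCat.{u} k) [F.Additive],
      FiniteDimensional k (F.obj (ModuleCat.of B B)) →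
      FiniteDimensional k (F.obj (ModuleCat.of B P)) ∧
      Module.finrank k (F.obj (ModuleCat.of B P)) =
        ∑ i, N i * Module.finrank k (LinearMap.range (F.map (rightMul (ε i))).hom) := by
  -- Induction on the dimension over `k`. The `k`-structure is an argument, so that submodules can
  -- be used with the structure they inherit.
  suffices key : ∀ (n : ℕ) (P : Type u) [AddCommGroup P] [Module k P] [Module B P] [IsScalarTower k B P]
      [Module.Finite B P] [Module.Projective B P], Module.finrank k P ≤ n →
      ∃ N : ι → ℕ, ∀ (F : ModuleCat.{u} B ⥤ ModuleCat.{u} k) [F.Additive],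
      FiniteDimensional k (F.obj (ModuleCat.of B B)) →
      FiniteDimensional k (F.obj (ModuleCat.of B P)) ∧
      Module.finrank k (F.obj (ModuleCat.of B P)) =
        ∑ i, N i * Module.finrank k (LinearMap.range (F.map (rightMul (ε i))).hom) by
    let : Module k P := Module.compHom P (algebraMap k B)
    have htower : IsScalarTower k B P := ⟨fun a b x => by
      change (a • b) • x = algebraMap k B a • b • x
      rw [Algebra.smul_def, mul_smul]⟩
    exact key _ P le_rfl
  intro n
  induction n with
  | zero =>
    intro P _ _ _ _ _ _ hP
    have : Module.Finite k P := Module.Finite.trans B P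
    have : Subsingleton P := Module.finrank_zero_iff.1 (Nat.le_zero.1 hP)
    refine ⟨0, fun F _ hF => ?_⟩
    have h0 : Limits.IsZero (F.obj (ModuleCat.of B P)) :=
      F.map_isZero (ModuleCat.isZero_of_subsingleton _)
    have := ModuleCat.subsingleton_of_isZero h0
    exact ⟨inferInstance, by simp [Module.finrank_zero_of_subsingleton]⟩
  | succ n ih =>
    intro P _ _ _ _ _ _ hP
    have : Module.Finite k P := Module.Finite.trans B P
    by_cases htriv : Module.finrank k P ≤ n
    · exact ih P htriv
    have : Nontrivial P := Module.nontrivial_of_finrank_pos (R := k) (by omega)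
    obtain ⟨i, p, ψ, hp, hψ⟩ := h.exists_dual_pair P
    have hid := h.complete.idem i
    -- `T` is an idempotent endomorphism with image `B p ≅ B εᵢ`; its kernel `Z` is the complement
    -- to which induction applies.
    set f : B →ₗ[B] P := LinearMap.toSpanSingleton B P p
    set T : P →ₗ[B] P := f ∘ₗ ψ
    have hT : ∀ x, T (T x) = T x := fun x => by
      simp only [T, f, LinearMap.comp_apply, LinearMap.toSpanSingleton_apply, map_smul, hψ, hp]
    set Z : Submodule B P := LinearMap.ker T
    set q : P →ₗ[B] Z := (LinearMap.id - T).codRestrict Z fun x => by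
      simp [Z, hT]
    have hqZ : q ∘ₗ Z.subtype = LinearMap.id := by
      ext z
      have : T z = 0 := z.2
      simp [q, this]
    have hfin : Module.Finite B Z := Module.Finite.of_surjective q fun z =>
      ⟨z, LinearMap.congr_fun hqZ z⟩
    have hproj : Module.Projective B Z := Module.Projective.of_split Z.subtype q hqZ
    -- `T p = p`, and `p ≠ 0` because `ψ p = ε i ≠ 0`; so `p` is not in `Z`.
    have hlt : Module.finrank k Z < Module.finrank k P := by
      have : (Z.restrictScalars k) < ⊤ := by
        rw [lt_top_iff_ne_top]
        intro htop
        have hpZ : p ∈ Z.restrictScalars k := htop ▸ Submodule.mem_top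
        have hTp : T p = 0 := hpZ
        have hTp' : T p = p := by simp [T, f, hψ, hp]
        refine h.ne_zero i ?_
        rw [← hψ, ← hTp', hTp, map_zero]
      exact Submodule.finrank_lt (s := Z.restrictScalars k) this.ne
    obtain ⟨N, hN⟩ := ih Z (by omega)
    refine ⟨fun l => (if l = i then 1 else 0) + N l, fun F _ hF => ?_⟩
    obtain ⟨hZfin, hZrank⟩ := hN F hF
    have key := finrank_map_of_splitting F (X := ModuleCat.of B P) (Y := ModuleCat.of B B)
      (Z := ModuleCat.of B Z) (ModuleCat.ofHom f)
      (ModuleCat.ofHom (LinearMap.toSpanSingleton B B (ε i) ∘ₗ ψ)) (ModuleCat.ofHom Z.subtype)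
      (ModuleCat.ofHom q)
      (by
        ext1
        apply LinearMap.ext_ring
        simp [f, hψ, hid.eq, hp])
      (by
        ext1
        exact hqZ)
      (by
        ext x
        simp [f, q, T, mul_smul, hp])
      hF hZfin
    refine ⟨key.1, key.2.trans ?_⟩
    have hfg : ModuleCat.ofHom f ≫ ModuleCat.ofHom (LinearMap.toSpanSingleton B B (ε i) ∘ₗ ψ)
        = rightMul (ε i) := by
      ext1
      apply LinearMap.ext_ring
      simp [f, hψ, rightMul, hid.eq]
    rw [hfg, hZrank]
    simp only [add_mul, Finset.sum_add_distrib, ite_mul, one_mul, zero_mul, Finset.sum_ite_eq',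
      Finset.mem_univ, if_true]

end Multiplicity

/-! ### Elementary algebras are split basic -/

section Elementary

theorem mem_jacobson_of_forall_isNilpotent_mul {B : Type*} [Ring B] {x : B}
    (hx : ∀ y, IsNilpotent (y * x)) : x ∈ Ring.jacobson B := by
  rw [← Ideal.jacobson_bot, Ideal.mem_jacobson_iff]
  intro y
  obtain ⟨u, hu⟩ := (hx y).isUnit_one_add
  refine ⟨(u⁻¹ : Bˣ), ?_⟩
  have : ((u⁻¹ : Bˣ) : B) * (1 + y * x) = 1 := by rw [← hu, Units.inv_mul]
  rw [Submodule.mem_bot, sub_eq_zero, ← this, mul_add, mul_one, mul_assoc, add_comm]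

/-- A multiplicative filtration that starts with a spanning set and ends with zero lies in the
radical from its first step on. -/
theorem span_le_jacobson_of_filtration {k B : Type*} [Field k] [Ring B] [Algebra k B]
    (S : ℕ → Set B) (hmul : ∀ m l, ∀ x ∈ S m, ∀ y ∈ S l, x * y ∈ S (m + l))
    (hzero : Submodule.span k (S 0) = ⊤) {n : ℕ} (hn : ∀ x ∈ S n, x = 0) {x : B}
    (hx : x ∈ Submodule.span k (S 1)) : x ∈ Ring.jacobson B := by
  have hmul' : ∀ m l, ∀ x ∈ Submodule.span k (S m), ∀ y ∈ Submodule.span k (S l),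
      x * y ∈ Submodule.span k (S (m + l)) := by
    intro m l x hx y hy
    have := Submodule.mul_mem_mul hx hy
    rw [Submodule.span_mul_span] at this
    refine Submodule.span_mono ?_ this
    rintro _ ⟨a, ha, b, hb, rfl⟩
    exact hmul m l a ha b hb
  apply mem_jacobson_of_forall_isNilpotent_mul
  intro y
  have hyx : y * x ∈ Submodule.span k (S 1) := by
    simpa using hmul' 0 1 y (hzero ▸ Submodule.mem_top) x hx
  -- Each factor `y * x` raises the filtration by one, so its `n`-th power vanishes.
  have hpow : ∀ m, (y * x) ^ m ∈ Submodule.span k (S m) := by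
    intro m
    induction m with
    | zero => exact hzero ▸ Submodule.mem_top
    | succ m ih =>
      rw [pow_succ]
      exact hmul' m 1 _ ih _ hyx
  refine ⟨n, ?_⟩
  have : Submodule.span k (S n) = ⊥ := by
    rw [Submodule.span_eq_bot]
    exact hn
  simpa [this] using hpow n

variable {k A : Type u} [Field k] [Ring A] [Algebra k A] [FiniteDimensional k A] {r : ℕ}

theorem exists_pow_jacobson_eq_bot (k A : Type u) [Field k] [Ring A] [Algebra k A]
    [FiniteDimensional k A] : ∃ n, Ring.jacobson A ^ n = ⊥ := by
  have : IsArtinianRing A := IsArtinianRing.of_finite k A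
  exact IsSemiprimaryRing.isNilpotent

/-- Over an elementary algebra with a complete family of primitive orthogonal idempotents `e`, the
semisimple quotient is a product of copies of `k` indexed by `e`. -/
theorem IsElementary.exists_algHom (helem : IsElementary k A) (e : Fin r → A)
    (hcomplete : CompleteOrthogonalIdempotents e) (hprim : ∀ i, IsPrimitiveIdempotent (e i)) :
    ∃ π : A →ₐ[k] (Fin r → k), (∀ i, π (e i) = Pi.single i 1) ∧
      ∀ a, π a = 0 → a ∈ Ring.jacobson A := by
  obtain ⟨m, ⟨φ⟩⟩ := helem
  set ρ : A →ₐ[k] (Fin m → k) := φ.toAlgHom.comp (Ideal.Quotient.mkₐ k (Ring.jacobson A))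
  have hker : ∀ a, ρ a = 0 → a ∈ Ring.jacobson A := by
    intro a ha
    have : Ideal.Quotient.mkₐ k (Ring.jacobson A) a = 0 := φ.injective (by simpa [ρ] using ha)
    exact Ideal.Quotient.eq_zero_iff_mem.1 this
  have hsurj : Function.Surjective ρ := φ.surjective.comp Ideal.Quotient.mk_surjective
  obtain ⟨n, hn⟩ := exists_pow_jacobson_eq_bot k A
  have hnil : ∀ x ∈ RingHom.ker (ρ : A →+* (Fin m → k)), IsNilpotent x := by
    intro x hx
    refine ⟨n, ?_⟩
    have : x ^ n ∈ Ring.jacobson A ^ n := Ideal.pow_mem_pow (hker x hx) n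
    simpa [hn] using this
  -- If `ρ (e i)` is nonzero at `t`, the coordinate idempotent at `t` lifts to an idempotent `f`
  -- below `e i`, and primitivity forces `f = e i`. Nonvanishing holds because a nilpotent
  -- idempotent is zero.
  have hstd : ∀ i, ∃ t, ρ (e i) = Pi.single t 1 := by
    intro i
    have hid := hcomplete.idem i
    have hρid : ρ (e i) * ρ (e i) = ρ (e i) := by rw [← map_mul, hid.eq]
    obtain ⟨t, ht⟩ : ∃ t, ρ (e i) t ≠ 0 := by
      by_contra hcon
      push Not at hcon
      obtain ⟨l, hl⟩ := hnil (e i) (funext hcon)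
      refine (hprim i).2.1 ?_
      have : e i ^ (l + 1) = e i := hid.pow_succ_eq l
      rw [← this, pow_succ, hl, zero_mul]
    have ht1 : ρ (e i) t = 1 := by
      have := congrFun hρid t
      exact mul_left_cancel₀ ht (by simpa using this)
    -- Lifting orthogonally to `1 - e i` is what puts `f` below `e i`.
    have hs : (Pi.single t 1 : Fin m → k) * ρ (1 - e i) = 0 := by
      ext l
      by_cases hl : l = t
      · subst hl; simp [ht1]
      · simp [hl]
    obtain ⟨f, hf, hρf, hf1, hf2⟩ := exists_isIdempotentElem_mul_eq_zero_of_ker_isNilpotent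
      (ρ : A →+* (Fin m → k)) hnil (Pi.single t 1) (hsurj _)
      (by ext l; by_cases hl : l = t <;> simp [hl]) (1 - e i) hid.one_sub hs
      (by rw [mul_comm]; exact hs)
    rw [mul_sub, mul_one, sub_eq_zero] at hf1
    rw [sub_mul, one_mul, sub_eq_zero] at hf2
    have hg : IsIdempotentElem (e i - f) := by
      rw [IsIdempotentElem, mul_sub, sub_mul, sub_mul, hid.eq, ← hf1, ← hf2, hf.eq]
      abel
    rcases (hprim i).2.2 f (e i - f) hf hg
      (by rw [mul_sub, ← hf1, hf.eq, sub_self]) (by rw [sub_mul, ← hf2, hf.eq, sub_self])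
      (by abel) with h0 | h0
    · rw [h0, map_zero] at hρf
      simpa using congrFun hρf t
    · exact ⟨t, by rw [sub_eq_zero.1 h0]; exact hρf⟩
  -- The map `σ` matches idempotents with coordinates: orthogonality of the `e i` makes it
  -- injective, and their sum being `1` makes it surjective, so no coordinate is lost from the
  -- kernel.
  choose σ hσ using hstd
  refine ⟨AlgHom.pi fun i => (Pi.evalAlgHom k (fun _ => k) (σ i)).comp ρ, fun i => ?_,
    fun a ha => hker a ?_⟩
  · ext j
    by_cases hij : j = i
    · subst hij; simp [hσ]
    · have h1 : ρ (e i * e j) (σ j) = 0 := by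
        rw [hcomplete.ortho (Ne.symm hij)]; simp
      have h2 : ρ (e j) (σ j) = 1 := by simp [hσ]
      rw [map_mul, Pi.mul_apply, h2, mul_one] at h1
      simpa [hij] using h1
  · ext t
    obtain ⟨i, hi⟩ : ∃ i, ρ (e i) t ≠ 0 := by
      by_contra hcon
      push Not at hcon
      have h1 := congrFun (congrArg ρ hcomplete.complete) t
      rw [map_sum, Finset.sum_apply, Finset.sum_eq_zero fun i _ => hcon i] at h1
      simp at h1
    have hti : t = σ i := by
      by_contra hne
      rw [hσ] at hi
      simp [hne] at hi
    have := congrFun ha i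
    rw [hti]
    simpa using this

variable {e : Fin r → A} {π : A →ₐ[k] (Fin r → k)}

-- The radical of the opposite ring is reached through nilpotency, a condition that does not
-- distinguish left from right.
omit [FiniteDimensional k A] in
theorem mem_jacobson_op_of_forall_isNilpotent (hnil : ∀ a, π a = 0 → IsNilpotent a)
    {b : Aᵐᵒᵖ} (hb : π b.unop = 0) : b ∈ Ring.jacobson Aᵐᵒᵖ := by
  apply mem_jacobson_of_forall_isNilpotent_mul
  intro y
  have : IsNilpotent (b.unop * y.unop) := hnil _ (by rw [map_mul, hb, zero_mul])
  obtain ⟨n, hn⟩ := this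
  refine ⟨n, MulOpposite.unop_injective ?_⟩
  simpa using hn

/-- The opposite of a split basic algebra is split basic. -/
theorem isSplitBasic_op (hcomplete : CompleteOrthogonalIdempotents e)
    (hπ : ∀ i, π (e i) = Pi.single i 1) (hker : ∀ a, π a = 0 → a ∈ Ring.jacobson A) :
    IsSplitBasic (fun i => MulOpposite.op (e i))
      (AlgHom.fromOpposite π fun x y => Commute.all (π x) (π y)) where
  complete :=
    { idem := fun i => congrArg MulOpposite.op (hcomplete.idem i)
      ortho := fun i j hij => congrArg MulOpposite.op (hcomplete.ortho hij.symm)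
      complete := by
        rw [← MulOpposite.op_one, ← hcomplete.complete, ← Finset.op_sum] }
  map_single i := by simpa using hπ i
  mem_jacobson b hb := by
    obtain ⟨n, hn⟩ := exists_pow_jacobson_eq_bot k A
    refine mem_jacobson_op_of_forall_isNilpotent (π := π) (fun a ha => ⟨n, ?_⟩) (by simpa using hb)
    have : a ^ n ∈ Ring.jacobson A ^ n := Ideal.pow_mem_pow (hker a ha) n
    simpa [hn] using this

/-- The semisimple quotient of the enveloping algebra. -/
def envAlgHom (π : A →ₐ[k] (Fin r → k)) : Env k A →ₐ[k] (Fin r × Fin r → k) :=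
  AlgHom.pi fun p => Algebra.TensorProduct.lift
    ((Pi.evalAlgHom k (fun _ => k) p.1).comp π)
    ((Pi.evalAlgHom k (fun _ => k) p.2).comp
      (AlgHom.fromOpposite π fun x y => Commute.all (π x) (π y)))
    fun _ _ => Commute.all _ _

omit [FiniteDimensional k A] in
theorem envAlgHom_tmul (a : A) (b : Aᵐᵒᵖ) (p : Fin r × Fin r) :
    envAlgHom π (a ⊗ₜ b) p = π a p.1 * π b.unop p.2 := by
  simp [envAlgHom]

/-- The idempotent `e_i ⊗ e_jᵒᵖ` of the enveloping algebra. -/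
def envIdempotent (k : Type u) [Field k] [Algebra k A] (e : Fin r → A) (p : Fin r × Fin r) :
    Env k A :=
  e p.1 ⊗ₜ[k] MulOpposite.op (e p.2)

-- This is the decomposition of `A` into the span of the `e i` and the radical.
omit [FiniteDimensional k A] in
theorem sub_sum_smul_mem_jacobson (hπ : ∀ i, π (e i) = Pi.single i 1)
    (hker : ∀ a, π a = 0 → a ∈ Ring.jacobson A) (a : A) :
    a - ∑ i, π a i • e i ∈ Ring.jacobson A := by
  apply hker
  rw [map_sub, map_sum, sub_eq_zero]
  ext j
  simp [hπ, Pi.single_apply]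

/-- The enveloping algebra of a split basic algebra is split basic. -/
theorem isSplitBasic_env (hcomplete : CompleteOrthogonalIdempotents e)
    (hπ : ∀ i, π (e i) = Pi.single i 1) (hker : ∀ a, π a = 0 → a ∈ Ring.jacobson A) :
    IsSplitBasic (envIdempotent k e) (envAlgHom π) where
  complete :=
    { idem := fun p => by
        rw [IsIdempotentElem, envIdempotent, Algebra.TensorProduct.tmul_mul_tmul,
          (hcomplete.idem p.1).eq, ← MulOpposite.op_mul, (hcomplete.idem p.2).eq]
      ortho := fun p q hpq => by
        change envIdempotent k e p * envIdempotent k e q = 0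
        rw [envIdempotent, envIdempotent, Algebra.TensorProduct.tmul_mul_tmul,
          ← MulOpposite.op_mul]
        by_cases h1 : p.1 = q.1
        · have h2 : q.2 ≠ p.2 := fun h2 => hpq (Prod.ext h1 h2.symm)
          rw [hcomplete.ortho h2, MulOpposite.op_zero, TensorProduct.tmul_zero]
        · rw [hcomplete.ortho h1, TensorProduct.zero_tmul]
      complete := by
        simp only [envIdempotent, Fintype.sum_prod_type, ← TensorProduct.tmul_sum,
          ← TensorProduct.sum_tmul, ← Finset.op_sum, hcomplete.complete,
          MulOpposite.op_one, Algebra.TensorProduct.one_def] }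
  map_single p := by
    ext q
    rw [envIdempotent, envAlgHom_tmul, MulOpposite.unop_op, hπ, hπ]
    simp only [Pi.single_apply, Prod.ext_iff]
    split_ifs <;> simp_all
  mem_jacobson x hx := by
    obtain ⟨n, hn⟩ := exists_pow_jacobson_eq_bot k A
    -- `S` and `S'` are the filtrations by powers of the radical in the left and in the right tensor
    -- factor; both end in zero, so their first steps lie in the radical of `Aᵉ`.
    set S : ℕ → Set (Env k A) := fun m => {z | ∃ a ∈ Ring.jacobson A ^ m, ∃ b, z = a ⊗ₜ[k] b}
    set S' : ℕ → Set (Env k A) := fun m =>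
      {z | ∃ a, ∃ b ∈ Ring.jacobson A ^ m, z = a ⊗ₜ[k] MulOpposite.op b}
    have hS : ∀ z ∈ Submodule.span k (S 1), z ∈ Ring.jacobson (Env k A) := fun z hz => by
      refine span_le_jacobson_of_filtration S ?_ ?_ (n := n) ?_ hz
      · rintro m l _ ⟨a, ha, b, rfl⟩ _ ⟨a', ha', b', rfl⟩
        refine ⟨a * a', ?_, b * b', Algebra.TensorProduct.tmul_mul_tmul _ _ _ _⟩
        rw [Ideal.IsTwoSided.pow_add]
        exact Ideal.mul_mem_mul ha ha'
      · rw [eq_top_iff, ← TensorProduct.span_tmul_eq_top]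
        refine Submodule.span_mono ?_
        rintro _ ⟨a, b, rfl⟩
        exact ⟨a, by simp [Submodule.pow_zero], b, rfl⟩
      · rintro _ ⟨a, ha, b, rfl⟩
        rw [hn, Submodule.mem_bot] at ha
        rw [ha, TensorProduct.zero_tmul]
    have hS' : ∀ z ∈ Submodule.span k (S' 1), z ∈ Ring.jacobson (Env k A) := fun z hz => by
      refine span_le_jacobson_of_filtration S' ?_ ?_ (n := n) ?_ hz
      · rintro m l _ ⟨a, b, hb, rfl⟩ _ ⟨a', b', hb', rfl⟩
        refine ⟨a * a', b' * b, ?_, Algebra.TensorProduct.tmul_mul_tmul _ _ _ _⟩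
        rw [add_comm, Ideal.IsTwoSided.pow_add]
        exact Ideal.mul_mem_mul hb' hb
      · rw [eq_top_iff, ← TensorProduct.span_tmul_eq_top]
        refine Submodule.span_mono ?_
        rintro _ ⟨a, b, rfl⟩
        exact ⟨a, b.unop, by simp [Submodule.pow_zero], rfl⟩
      · rintro _ ⟨a, b, hb, rfl⟩
        rw [hn, Submodule.mem_bot] at hb
        rw [hb, MulOpposite.op_zero, TensorProduct.tmul_zero]
    -- Every element agrees with its diagonal part modulo the radical, and elements of the kernel
    -- have diagonal part zero.
    have hsub : ∀ z : Env k A, z - ∑ p, envAlgHom π z p • envIdempotent k e p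
        ∈ Ring.jacobson (Env k A) := by
      intro z
      induction z using TensorProduct.induction_on with
      | zero => simp
      | add x y hx hy =>
        have := add_mem hx hy
        convert! this using 1
        simp only [map_add, Pi.add_apply, add_smul, Finset.sum_add_distrib]
        abel
      | tmul a b =>
        set a₀ := ∑ i, π a i • e i
        set b₀ := ∑ i, π b.unop i • e i
        have hsum : ∑ p, envAlgHom π (a ⊗ₜ[k] b) p • envIdempotent k e p
            = a₀ ⊗ₜ[k] MulOpposite.op b₀ := by
          simp only [a₀, b₀, Fintype.sum_prod_type, envAlgHom_tmul, envIdempotent,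
            Finset.op_sum, TensorProduct.sum_tmul, TensorProduct.tmul_sum,
            MulOpposite.op_smul, TensorProduct.smul_tmul_smul]
          exact Finset.sum_comm
        have hsplit : a ⊗ₜ[k] b - a₀ ⊗ₜ[k] MulOpposite.op b₀
            = (a - a₀) ⊗ₜ[k] b + a₀ ⊗ₜ[k] MulOpposite.op (b.unop - b₀) := by
          rw [MulOpposite.op_sub, MulOpposite.op_unop, TensorProduct.sub_tmul,
            TensorProduct.tmul_sub]
          abel
        rw [hsum, hsplit]
        refine add_mem (hS _ (Submodule.subset_span ⟨_, ?_, b, rfl⟩))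
          (hS' _ (Submodule.subset_span ⟨a₀, _, ?_, rfl⟩))
        · rw [Submodule.pow_one]
          exact sub_sum_smul_mem_jacobson hπ hker a
        · rw [Submodule.pow_one]
          exact sub_sum_smul_mem_jacobson hπ hker b.unop
    simpa [hx] using hsub x

end Elementary

/-! ### The functors `X ↦ b X` -/

section Cut

open scoped ModuleCat

theorem finrank_range_eq_of_conj {k V W : Type*} [Field k] [AddCommGroup V] [Module k V]
    [AddCommGroup W] [Module k W] (φ : V ≃ₗ[k] W) (f : V →ₗ[k] V) (g : W →ₗ[k] W)
    (h : ∀ x, φ (f x) = g (φ x)) :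
    Module.finrank k (LinearMap.range f) = Module.finrank k (LinearMap.range g) := by
  have : LinearMap.range g = (LinearMap.range f).map (φ : V →ₗ[k] W) := by
    ext y
    constructor
    · rintro ⟨x, rfl⟩
      exact ⟨f (φ.symm x), ⟨_, rfl⟩, by simp [h]⟩
    · rintro ⟨_, ⟨x, rfl⟩, rfl⟩
      exact ⟨φ x, (h x).symm⟩
  rw [this, LinearEquiv.finrank_map_eq]

variable {k B : Type u} [Field k] [Ring B] [Algebra k B]

/-- The functor `X ↦ b X` from modules to vector spaces. -/
def cutFunctor (k : Type u) [Field k] [Algebra k B] (b : B) :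
    ModuleCat.{u} B ⥤ ModuleCat.{u} k where
  obj X := ModuleCat.of k (LinearMap.range (Algebra.lsmul k k X b))
  map {X Y} f := ModuleCat.ofHom
    { toFun := fun x => ⟨f.hom x, by
        obtain ⟨y, hy⟩ := x.2
        exact ⟨f.hom y, by
          rw [← hy]
          exact (map_smul f.hom b y).symm⟩⟩
      map_add' := fun x y => Subtype.ext (map_add f.hom (x : X) y)
      map_smul' := fun c x => Subtype.ext
        (map_smul f.hom (algebraMap k B c) (x : X)) }

instance (b : B) : (cutFunctor k b).Additive where
  map_add := rfl

/-- For idempotent `b`, a preimage `x` of an element of `b X` may be replaced by `b • x`. -/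
theorem cutFunctor_exact {b : B} (hb : IsIdempotentElem b) (S : ShortComplex (ModuleCat.{u} B))
    (hS : S.Exact) : (S.map (cutFunctor k b)).Exact := by
  rw [ShortComplex.moduleCat_exact_iff] at hS ⊢
  rintro ⟨y, hy⟩ hgy
  obtain ⟨x, hx⟩ := hS y (congrArg Subtype.val hgy)
  refine ⟨⟨b • x, ⟨x, rfl⟩⟩, Subtype.ext ?_⟩
  change S.f.hom (b • x) = y
  obtain ⟨z, hz⟩ := hy
  have hz' : b • z = y := hz
  rw [map_smul]
  change b • (S.f x) = y
  rw [hx, ← hz', smul_smul, hb.eq]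

theorem cutFunctor_preservesHomology {b : B} (hb : IsIdempotentElem b) :
    (cutFunctor k b).PreservesHomology :=
  ((cutFunctor k b).exact_tfae.out 1 2).1 (cutFunctor_exact hb)

theorem cutFunctor_shortExact {b : B} (hb : IsIdempotentElem b) {S : ShortComplex (ModuleCat.{u} B)}
    (hS : S.ShortExact) : (S.map (cutFunctor k b)).ShortExact :=
  (((cutFunctor k b).exact_tfae.out 1 0 :) : _ ↔ ∀ S : ShortComplex (ModuleCat.{u} B), S.ShortExact →
    (S.map (cutFunctor k b)).ShortExact).1 (cutFunctor_exact hb) S hS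

theorem finiteDimensional_moduleCat [FiniteDimensional k B] (X : ModuleCat.{u} B)
    [Module.Finite B X] : FiniteDimensional k X :=
  Module.Finite.trans B X

theorem finiteDimensional_cutFunctor [FiniteDimensional k B] (b : B) (X : ModuleCat.{u} B)
    [Module.Finite B X] : FiniteDimensional k ((cutFunctor k b).obj X) := by
  have := finiteDimensional_moduleCat (k := k) X
  exact inferInstanceAs (FiniteDimensional k (LinearMap.range (Algebra.lsmul k k X b)))

theorem finrank_range_comp_of_injective {k U V W : Type*} [Field k] [AddCommGroup U] [Module k U]
    [AddCommGroup V] [Module k V] [AddCommGroup W] [Module k W] (f : U →ₗ[k] V) (g : V →ₗ[k] W)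
    (hg : Function.Injective g) :
    Module.finrank k (LinearMap.range (g ∘ₗ f)) = Module.finrank k (LinearMap.range f) := by
  rw [LinearMap.range_comp]
  exact (LinearEquiv.finrank_eq (Submodule.equivMapOfInjective g hg _)).symm

/-- The inclusion `b B → B`. -/
def cutInclusion (k : Type u) [Field k] [Algebra k B] (b : B) :
    (cutFunctor k b).obj (ModuleCat.of B B) →ₗ[k] B where
  toFun x := (x : LinearMap.range (Algebra.lsmul k k (ModuleCat.of B B) b)).1
  map_add' _ _ := rfl
  map_smul' a _ := (Algebra.smul_def a _).symm

/-- The image of right multiplication by `c` on `b B` is `b B c`. -/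
theorem finrank_range_cutFunctor_map_rightMul (b c : B) :
    Module.finrank k (LinearMap.range ((cutFunctor k b).map (rightMul c)).hom)
      = Module.finrank k (LinearMap.range (LinearMap.mulLeftRight k (b, c))) := by
  rw [← finrank_range_comp_of_injective _ (cutInclusion k b) Subtype.val_injective]
  have h : LinearMap.range (cutInclusion k b ∘ₗ ((cutFunctor k b).map (rightMul c)).hom)
      = LinearMap.range (LinearMap.mulLeftRight k (b, c)) := by
    ext y
    constructor
    · rintro ⟨⟨_, ⟨x, rfl⟩⟩, rfl⟩
      exact ⟨x, LinearMap.mulLeftRight_apply _ _ _⟩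
    · rintro ⟨x, rfl⟩
      exact ⟨⟨(b * x : B), ⟨x, rfl⟩⟩, (LinearMap.mulLeftRight_apply _ _ _).symm⟩
  rw [h]

end Cut

/-! ### Invertibility of the Cartan matrix -/

section CartanInvertible

open scoped ModuleCat

variable {k A : Type u} [Field k] [Ring A] [Algebra k A] {r : ℕ}

/-- The swap of indices is the convention that the entry `(i, j)` measures `e_j X e_i`. -/
theorem cartanMatrix_apply (e : Fin r → A) (X : Bimod k A) (i j : Fin r) :
    cartanMatrix e X i j
      = Module.finrank k ((cutFunctor k (envIdempotent k e (j, i))).obj X) := rfl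

theorem cartanMatrixAlgebra_apply (e : Fin r → A) (i j : Fin r) :
    cartanMatrixAlgebra k e i j
      = Module.finrank k (LinearMap.range (LinearMap.mulLeftRight k (e j, e i))) := by
  let φ : regularBimodule k A ≃ₗ[k] A :=
    { AddEquiv.refl A with
      map_smul' := fun c x => by
        let : Module (Env k A) A := TensorProduct.Algebra.module
        change (algebraMap k (Env k A) c) • (show A from x) = c • (show A from x)
        rw [Algebra.TensorProduct.algebraMap_apply, TensorProduct.Algebra.smul_def, one_smul,
          algebraMap_smul] }
  change ((Module.finrank k (LinearMap.range (Algebra.lsmul k k (regularBimodule k A)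
    (e j ⊗ₜ[k] MulOpposite.op (e i) : Env k A))) : ℕ) : ℤ) = _
  rw [finrank_range_eq_of_conj φ _ (LinearMap.mulLeftRight k (e j, e i))]
  intro x
  let : Module (Env k A) A := TensorProduct.Algebra.module
  change (e j ⊗ₜ[k] MulOpposite.op (e i) : Env k A) • (show A from x) = _
  rw [TensorProduct.Algebra.smul_def, LinearMap.mulLeftRight_apply]
  exact (mul_assoc (e j) (show A from x) (e i)).symm

/-- The dimension vector of a right module. -/
def dimVec (k : Type u) [Field k] [Algebra k A] (e : Fin r → A) (X : ModuleCat.{u} Aᵐᵒᵖ)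
    (i : Fin r) : ℤ :=
  Module.finrank k ((cutFunctor k (MulOpposite.op (e i))).obj X)

theorem finrank_of_shortExact {S : ShortComplex (ModuleCat.{u} k)} (hS : S.ShortExact)
    [FiniteDimensional k S.X₂] :
    Module.finrank k S.X₂ = Module.finrank k S.X₁ + Module.finrank k S.X₃ := by
  have h1 := LinearMap.finrank_range_add_finrank_ker S.g.hom
  have hsurj : Function.Surjective S.g.hom := (ModuleCat.epi_iff_surjective _).1 hS.epi_g
  have hinj : Function.Injective S.f.hom := (ModuleCat.mono_iff_injective _).1 hS.mono_f
  rw [LinearMap.range_eq_top.2 hsurj, finrank_top,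
    ← (ShortComplex.moduleCat_exact_iff_range_eq_ker S).1 hS.exact,
    LinearMap.finrank_range_of_inj hinj] at h1
  omega

variable [FiniteDimensional k A]

theorem dimVec_of_shortExact {e : Fin r → A} (he : ∀ i, IsIdempotentElem (e i))
    {S : ShortComplex (ModuleCat.{u} Aᵐᵒᵖ)} (hS : S.ShortExact) [Module.Finite Aᵐᵒᵖ S.X₂] :
    dimVec k e S.X₂ = dimVec k e S.X₁ + dimVec k e S.X₃ := by
  ext i
  have hop : IsIdempotentElem (MulOpposite.op (e i)) := congrArg MulOpposite.op (he i)
  have : FiniteDimensional k (S.map (cutFunctor k (MulOpposite.op (e i)))).X₂ :=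
    finiteDimensional_cutFunctor _ S.X₂
  have := finrank_of_shortExact (cutFunctor_shortExact (k := k) hop hS)
  simp only [dimVec, Pi.add_apply]
  exact_mod_cast this

/-- The right projective `e_a A` has dimension vector `dim e_a A e_i`, which is the column `a` of
the Cartan matrix; `z` lists the multiplicities. -/
theorem dimVec_of_projective {e : Fin r → A} {ι : Aᵐᵒᵖ →ₐ[k] (Fin r → k)}
    (h : IsSplitBasic (fun i => MulOpposite.op (e i)) ι) (X : ModuleCat.{u} Aᵐᵒᵖ)
    [Module.Finite Aᵐᵒᵖ X] [Module.Projective Aᵐᵒᵖ X] :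
    ∃ z : Fin r → ℤ, dimVec k e X = (cartanMatrixAlgebra k e).mulVec z := by
  obtain ⟨N, hN⟩ := h.exists_multiplicity X
  refine ⟨fun a => N a, ?_⟩
  ext i
  have hfin : FiniteDimensional k
      ((cutFunctor k (MulOpposite.op (e i))).obj (ModuleCat.of Aᵐᵒᵖ Aᵐᵒᵖ)) :=
    finiteDimensional_cutFunctor _ _
  have hi := (hN (cutFunctor k (MulOpposite.op (e i))) hfin).2
  change ((Module.finrank k ((cutFunctor k (MulOpposite.op (e i))).obj (ModuleCat.of Aᵐᵒᵖ X))
    : ℕ) : ℤ) = _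
  rw [hi, Matrix.mulVec, dotProduct]
  push_cast
  refine Finset.sum_congr rfl fun a _ => ?_
  rw [mul_comm, finrank_range_cutFunctor_map_rightMul, cartanMatrixAlgebra_apply,
    finrank_range_eq_of_conj (MulOpposite.opLinearEquiv k).symm _
      (LinearMap.mulLeftRight k (e a, e i))]
  intro x
  simp [LinearMap.mulLeftRight_apply, mul_assoc]

/-- The dimension vector of a finitely generated module of finite projective dimension is an
integral combination of those of the projectives. -/
theorem dimVec_mem_range_cartanMatrix {e : Fin r → A} {ι : Aᵐᵒᵖ →ₐ[k] (Fin r → k)}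
    (h : IsSplitBasic (fun i => MulOpposite.op (e i)) ι) (d : ℕ) (X : ModuleCat.{u} Aᵐᵒᵖ)
    [Module.Finite Aᵐᵒᵖ X] [hd : HasProjectiveDimensionLE X d] :
    ∃ z : Fin r → ℤ, dimVec k e X = (cartanMatrixAlgebra k e).mulVec z := by
  have he : ∀ i, IsIdempotentElem (e i) := fun i =>
    congrArg MulOpposite.unop (h.complete.idem i)
  have hnoeth : IsNoetherianRing Aᵐᵒᵖ := IsNoetherianRing.of_finite k Aᵐᵒᵖ
  induction d generalizing X with
  | zero =>
    have : Projective X := projective_iff_hasProjectiveDimensionLT_one.2 hd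
    have : Module.Projective Aᵐᵒᵖ X := (IsProjective.iff_projective X).2 this
    exact dimVec_of_projective h X
  | succ d ih =>
    -- The kernel of a finite free cover is finitely generated, as the ring is noetherian, and has
    -- smaller projective dimension; dimension vectors subtract.
    obtain ⟨n, f, hf⟩ := Module.Finite.exists_fin' Aᵐᵒᵖ X
    let S : ShortComplex (ModuleCat.{u} Aᵐᵒᵖ) :=
      ShortComplex.mk (ModuleCat.ofHom (LinearMap.ker f).subtype)
        (ModuleCat.ofHom (Y := X) f) (by ext x; exact x.2)
    have hS : S.ShortExact :=
      { exact := by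
          rw [ShortComplex.moduleCat_exact_iff_range_eq_ker]
          exact Submodule.range_subtype _
        mono_f := (ModuleCat.mono_iff_injective _).2 (Submodule.injective_subtype _)
        epi_g := (ModuleCat.epi_iff_surjective _).2 hf }
    have : Module.Finite Aᵐᵒᵖ S.X₂ := inferInstanceAs (Module.Finite Aᵐᵒᵖ (Fin n → Aᵐᵒᵖ))
    have hp : Module.Projective Aᵐᵒᵖ S.X₂ :=
      inferInstanceAs (Module.Projective Aᵐᵒᵖ (Fin n → Aᵐᵒᵖ))
    have hp' : Projective S.X₂ := (IsProjective.iff_projective S.X₂).1 hp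
    have : Module.Finite Aᵐᵒᵖ S.X₁ := inferInstanceAs (Module.Finite Aᵐᵒᵖ (LinearMap.ker f))
    have hX₁ : HasProjectiveDimensionLE S.X₁ d :=
      (hS.hasProjectiveDimensionLT_X₃_iff d hp').1 hd
    obtain ⟨z₁, hz₁⟩ := ih S.X₁
    obtain ⟨z₂, hz₂⟩ := dimVec_of_projective h S.X₂
    refine ⟨z₂ - z₁, ?_⟩
    have := dimVec_of_shortExact (k := k) he hS
    rw [Matrix.mulVec_sub, ← hz₁, ← hz₂, this]
    exact (add_sub_cancel_left _ _).symm

/-- The simple right module at the vertex `a`. -/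
def simpleModule (ι : Aᵐᵒᵖ →ₐ[k] (Fin r → k)) (a : Fin r) : ModuleCat.{u} Aᵐᵒᵖ :=
  (ModuleCat.restrictScalars ((Pi.evalRingHom (fun _ => k) a).comp (ι : Aᵐᵒᵖ →+* (Fin r → k)))).obj
    (ModuleCat.of k k)

omit [FiniteDimensional k A] in
/-- The identification of the simple right module with `k`. -/
def simpleModuleEquiv (ι : Aᵐᵒᵖ →ₐ[k] (Fin r → k)) (a : Fin r) : simpleModule ι a ≃ₗ[k] k :=
  { AddEquiv.refl k with
    map_smul' := fun c x => by
      change ι (algebraMap k Aᵐᵒᵖ c) a * (show k from x) = c * (show k from x)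
      rw [AlgHom.commutes]
      rfl }

omit [FiniteDimensional k A] in
theorem dimVec_simpleModule {e : Fin r → A} {ι : Aᵐᵒᵖ →ₐ[k] (Fin r → k)}
    (h : IsSplitBasic (fun i => MulOpposite.op (e i)) ι) (a : Fin r) :
    dimVec k e (simpleModule ι a) = Pi.single a 1 := by
  ext i
  change ((Module.finrank k (LinearMap.range
    (Algebra.lsmul k k (simpleModule ι a) (MulOpposite.op (e i)))) : ℕ) : ℤ) = _
  rw [finrank_range_eq_of_conj (simpleModuleEquiv ι a) _
    (LinearMap.lsmul k k (ι (MulOpposite.op (e i)) a))]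
  · rw [h.map_single]
    by_cases hi : i = a
    · subst hi
      have : LinearMap.lsmul k k (1 : k) = LinearMap.id := by ext; simp
      rw [Pi.single_eq_same, this, LinearMap.range_id]
      simp
    · simp [hi, Ne.symm hi]
  · intro x
    rfl

/-- The dimension vectors of the simples are the unit vectors. Each is an integral combination of
the columns of the Cartan matrix, and the coefficients form a right inverse. -/
theorem isUnit_det_cartanMatrixAlgebra (hgl : FiniteGlobalDimension A) {e : Fin r → A}
    {ι : Aᵐᵒᵖ →ₐ[k] (Fin r → k)} (h : IsSplitBasic (fun i => MulOpposite.op (e i)) ι) :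
    IsUnit (cartanMatrixAlgebra k e).det := by
  obtain ⟨d, hd⟩ := hgl
  have hcol : ∀ a, ∃ z : Fin r → ℤ, Pi.single a 1 = (cartanMatrixAlgebra k e).mulVec z := by
    intro a
    have hfin : FiniteDimensional k (simpleModule ι a) :=
      Module.Finite.equiv (simpleModuleEquiv ι a).symm
    have : Module.Finite Aᵐᵒᵖ (simpleModule ι a) := Module.Finite.of_restrictScalars_finite k _ _
    have := hd (simpleModule ι a)
    rw [← dimVec_simpleModule h a]
    exact dimVec_mem_range_cartanMatrix h d _
  choose z hz using hcol
  have hmul : cartanMatrixAlgebra k e * (Matrix.of z).transpose = 1 := by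
    ext i a
    have := congrFun (hz a) i
    rw [Matrix.mul_apply, Matrix.one_apply]
    simp only [Matrix.mulVec, dotProduct, Pi.single_apply] at this
    exact this.symm
  exact Matrix.isUnit_det_of_right_inverse hmul

end CartanInvertible

/-! ### Tensor products with the free bimodule of rank one -/

section FreeBimodule

open scoped ModuleCat

variable {k A : Type u} [Field k] [Ring A] [Algebra k A]

theorem finrank_range_cutFunctor_map {B : Type u} [Ring B] [Algebra k B] (b : B)
    {X : ModuleCat.{u} B} (f : X ⟶ X) :
    Module.finrank k (LinearMap.range ((cutFunctor k b).map f).hom)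
      = Module.finrank k (LinearMap.range
        (Algebra.lsmul k k X b ∘ₗ (f.hom.restrictScalars k))) := by
  let inc : (cutFunctor k b).obj X →ₗ[k] X := (LinearMap.range (Algebra.lsmul k k X b)).subtype
  rw [← finrank_range_comp_of_injective _ inc Subtype.val_injective]
  have h : LinearMap.range (inc ∘ₗ ((cutFunctor k b).map f).hom)
      = LinearMap.range (Algebra.lsmul k k X b ∘ₗ (f.hom.restrictScalars k)) := by
    ext y
    constructor
    · rintro ⟨⟨_, ⟨x, rfl⟩⟩, rfl⟩
      exact ⟨x, (map_smul f.hom b x).symm⟩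
    · rintro ⟨x, rfl⟩
      exact ⟨⟨b • x, ⟨x, rfl⟩⟩, map_smul f.hom b x⟩
  rw [h]

variable (k A) in
/-- The free bimodule of rank one. -/
def freeBimodule : Bimod k A := ModuleCat.of (Env k A) (Env k A)

/-- The element `a ⊗ b` of the free bimodule of rank one. -/
def freeMk (k : Type u) [Field k] [Algebra k A] (a b : A) : freeBimodule k A :=
  (a ⊗ₜ[k] MulOpposite.op b : Env k A)

theorem freeBimodule_induction {p : freeBimodule k A → Prop} (x : freeBimodule k A) (zero : p 0)
    (add : ∀ x y, p x → p y → p (x + y)) (mk : ∀ a b, p (freeMk k a b)) : p x :=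
  TensorProduct.induction_on (motive := p) x zero (fun a b => mk a b.unop) add

theorem smul_freeMk (a b c d : A) :
    (a ⊗ₜ[k] MulOpposite.op b : Env k A) • freeMk k c d = freeMk k (a * c) (d * b) :=
  Algebra.TensorProduct.tmul_mul_tmul _ _ _ _

variable (k A) in
/-- The free bimodule of rank one, as a vector space. -/
def freeBimoduleEquiv : freeBimodule k A ≃ₗ[k] A ⊗[k] Aᵐᵒᵖ :=
  { AddEquiv.refl (Env k A) with
    map_smul' := fun c x => (Algebra.smul_def (A := Env k A) c x).symm }

variable (k) in
/-- The element `a` of the regular bimodule. -/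
def regMk (a : A) : regularBimodule k A := a

theorem smul_regMk (a b c : A) :
    (a ⊗ₜ[k] MulOpposite.op b : Env k A) • regMk k c = regMk k (a * c * b) := by
  let : Module (Env k A) A := TensorProduct.Algebra.module
  change (a ⊗ₜ[k] MulOpposite.op b : Env k A) • c = a * c * b
  rw [TensorProduct.Algebra.smul_def]
  exact (mul_assoc _ _ _).symm

variable (k A) in
/-- The regular bimodule, as a vector space. -/
def regularBimoduleEquiv : A ≃ₗ[k] regularBimodule k A :=
  { AddEquiv.refl A with
    map_smul' := fun c x => by
      have := smul_regMk (k := k) (algebraMap k A c) 1 x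
      rw [mul_one, ← Algebra.smul_def] at this
      exact this.symm }

variable (K : Bimod k A)

/-- The right action of `A` on a bimodule. -/
def rightAction : K →ₗ[k] A →ₗ[k] K :=
  LinearMap.mk₂ k (fun m a => ((1 : A) ⊗ₜ[k] MulOpposite.op a : Env k A) • m)
    (fun m m' a => smul_add _ m m')
    (fun c m a => smul_comm _ c m)
    (fun m a b => by rw [MulOpposite.op_add, TensorProduct.tmul_add, add_smul])
    (fun c m a => by rw [MulOpposite.op_smul, TensorProduct.tmul_smul, smul_assoc])

/-- The map `K ⊗ₖ (A ⊗ₖ Aᵒᵖ) → K ⊗ₖ A`, `m ⊗ (a ⊗ b) ↦ m a ⊗ b`. -/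
def freeContract : K ⊗[k] freeBimodule k A →ₗ[k] K ⊗[k] regularBimodule k A :=
  (TensorProduct.map (TensorProduct.lift (rightAction K))
    ((regularBimoduleEquiv k A).toLinearMap ∘ₗ (MulOpposite.opLinearEquiv k).symm.toLinearMap))
    ∘ₗ (TensorProduct.assoc k K A Aᵐᵒᵖ).symm.toLinearMap
    ∘ₗ LinearMap.lTensor K (freeBimoduleEquiv k A).toLinearMap

theorem freeContract_tmul (m : K) (a b : A) :
    freeContract K (m ⊗ₜ[k] freeMk k a b)
      = (((1 : A) ⊗ₜ[k] MulOpposite.op a : Env k A) • m) ⊗ₜ[k] regMk k b :=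
  rfl

/-- `freeContract`, as a map of bimodules. -/
def freeContractBimod : OuterTensor k A K (freeBimodule k A) →ₗ[Env k A]
    OuterTensor k A K (regularBimodule k A) where
  toFun := freeContract K
  map_add' := map_add _
  map_smul' r z := by
    change freeContract K (outerAction k A K (freeBimodule k A) r z)
      = outerAction k A K (regularBimodule k A) r (freeContract K z)
    refine LinearMap.congr_fun (f := freeContract K ∘ₗ outerAction k A K (freeBimodule k A) r)
      (g := outerAction k A K (regularBimodule k A) r ∘ₗ freeContract K) ?_ z
    induction r using TensorProduct.induction_on with
    | zero => simp
    | add x y hx hy =>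
      rw [map_add, map_add, LinearMap.comp_add, LinearMap.add_comp, hx, hy]
    | tmul a b =>
      apply TensorProduct.ext'
      intro m z
      induction z using freeBimodule_induction with
      | zero => rw [TensorProduct.tmul_zero, map_zero, map_zero]
      | add x y hx hy => rw [TensorProduct.tmul_add, map_add, map_add, hx, hy]
      | mk c d =>
        rw [LinearMap.comp_apply, LinearMap.comp_apply, outerAction_tmul, freeContract_tmul,
          outerAction_tmul, ← MulOpposite.op_unop b, smul_freeMk, freeContract_tmul, smul_regMk,
          smul_smul, smul_smul, Algebra.TensorProduct.tmul_mul_tmul,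
          Algebra.TensorProduct.tmul_mul_tmul]
        simp

/-- The tensor product `K ⊗_A Aᵉ`. -/
abbrev tensorFree : Bimod k A := ((tensorBifunctor k A).obj K).obj (freeBimodule k A)

/-- The map of bimodules `K ⊗_A Aᵉ → K ⊗ₖ A`. -/
def tensorFreeToOuter : BimodTensor k A K (freeBimodule k A) →ₗ[Env k A]
    OuterTensor k A K (regularBimodule k A) :=
  Submodule.liftQ _ (freeContractBimod K) (by
    refine Submodule.span_le.2 ?_
    rintro _ ⟨m, a, z, rfl⟩
    rw [SetLike.mem_coe, LinearMap.mem_ker, map_sub, sub_eq_zero]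
    change freeContract K (_ ⊗ₜ z) = freeContract K (_ ⊗ₜ (_ • z))
    induction z using freeBimodule_induction with
    | zero => rw [smul_zero, TensorProduct.tmul_zero, TensorProduct.tmul_zero]
    | add x y hx hy =>
      rw [smul_add, TensorProduct.tmul_add, TensorProduct.tmul_add, map_add, map_add, hx, hy]
    | mk c d =>
      rw [← MulOpposite.op_one, smul_freeMk, freeContract_tmul, freeContract_tmul, smul_smul,
        Algebra.TensorProduct.tmul_mul_tmul]
      simp)

/-- The linear map `K ⊗_A Aᵉ → K ⊗ₖ A`, `m ⊗ (a ⊗ b) ↦ m a ⊗ b`. -/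
def tensorFreeMap : tensorFree K →ₗ[k] K ⊗[k] regularBimodule k A where
  toFun := tensorFreeToOuter K
  map_add' := map_add (tensorFreeToOuter K)
  map_smul' c v := by
    refine (map_smul (tensorFreeToOuter K) (algebraMap k (Env k A) c) _).trans ?_
    change outerAction k A K (regularBimodule k A) (algebraMap k (Env k A) c) _ = _
    rw [AlgHom.commutes]
    rfl

theorem tensorFreeMap_tensorMk (m : K) (a b : A) :
    tensorFreeMap K (tensorMk k A m (freeMk k a b))
      = (((1 : A) ⊗ₜ[k] MulOpposite.op a : Env k A) • m) ⊗ₜ[k] regMk k b :=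
  rfl

/-- Balancing gives `m ⊗ (a ⊗ b) = m a ⊗ (1 ⊗ b)`, so generators with first entry `1` suffice. -/
theorem tensorFree_induction {p : tensorFree K → Prop} (x : tensorFree K) (zero : p 0)
    (add : ∀ x y, p x → p y → p (x + y)) (mk : ∀ (m : K) (b : A), p (tensorMk k A m (freeMk k 1 b))) :
    p x := by
  obtain ⟨x, rfl⟩ := Submodule.Quotient.mk_surjective _ x
  refine TensorProduct.induction_on (R := k)
    (motive := fun x : K ⊗[k] freeBimodule k A => p (Submodule.Quotient.mk x)) x zero ?_
    (fun x y hx hy => add _ _ hx hy)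
  intro m z
  induction z using freeBimodule_induction with
  | zero => rw [TensorProduct.tmul_zero]; exact zero
  | add x y hx hy => rw [TensorProduct.tmul_add]; exact add _ _ hx hy
  | mk a b =>
    have hmem : outerMk k A K (freeBimodule k A)
          (((1 : A) ⊗ₜ[k] MulOpposite.op a : Env k A) • m) (freeMk k 1 b)
        - outerMk k A K (freeBimodule k A) m (freeMk k a b)
        ∈ balancing k A K (freeBimodule k A) := by
      refine Submodule.subset_span ⟨m, a, freeMk k 1 b, ?_⟩
      rw [← MulOpposite.op_one, smul_freeMk, mul_one, mul_one]
    have h := (Submodule.Quotient.eq _).2 hmem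
    change p (Submodule.Quotient.mk (outerMk k A K (freeBimodule k A) m (freeMk k a b)))
    rw [← h]
    exact mk _ b

/-- The map `K ⊗ₖ A → K ⊗_A Aᵉ`, `m ⊗ b ↦ m ⊗ (1 ⊗ b)`. -/
def tensorFreeInv : K ⊗[k] regularBimodule k A →+ tensorFree K :=
  AddMonoidHom.comp (M := K ⊗[k] regularBimodule k A) (N := OuterTensor k A K (freeBimodule k A))
    (balancing k A K (freeBimodule k A)).mkQ.toAddMonoidHom
    (LinearMap.lTensor K ((freeBimoduleEquiv k A).symm.toLinearMap
      ∘ₗ TensorProduct.mk k A Aᵐᵒᵖ 1 ∘ₗ (MulOpposite.opLinearEquiv k).toLinearMap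
      ∘ₗ (regularBimoduleEquiv k A).symm.toLinearMap)).toAddMonoidHom

theorem tensorFreeInv_tmul (m : K) (b : A) :
    tensorFreeInv K (m ⊗ₜ[k] regMk k b) = tensorMk k A m (freeMk k 1 b) := rfl

/-- `K ⊗_A Aᵉ` is `K ⊗ₖ A` as a vector space. -/
def tensorFreeEquiv : tensorFree K ≃ₗ[k] K ⊗[k] regularBimodule k A :=
  { tensorFreeMap K with
    invFun := tensorFreeInv K
    left_inv := fun x => by
      change tensorFreeInv K (tensorFreeMap K x) = x
      induction x using tensorFree_induction with
      | zero => rw [map_zero, map_zero]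
      | add x y hx hy => rw [map_add, map_add, hx, hy]
      | mk m b =>
        rw [tensorFreeMap_tensorMk, tensorFreeInv_tmul, MulOpposite.op_one,
          ← Algebra.TensorProduct.one_def, one_smul]
    right_inv := fun x => by
      change tensorFreeMap K (tensorFreeInv K x) = x
      induction x using TensorProduct.induction_on with
      | zero => rw [map_zero, map_zero]
      | add x y hx hy => rw [map_add, map_add, hx, hy]
      | tmul m b =>
        obtain ⟨b, rfl⟩ : ∃ b', regMk k b' = b := ⟨b, rfl⟩
        rw [tensorFreeInv_tmul, tensorFreeMap_tensorMk, MulOpposite.op_one,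
          ← Algebra.TensorProduct.one_def, one_smul] }

theorem tensorFreeEquiv_tensorMk (m : K) (a b : A) :
    tensorFreeEquiv K (tensorMk k A m (freeMk k a b))
      = (((1 : A) ⊗ₜ[k] MulOpposite.op a : Env k A) • m) ⊗ₜ[k] regMk k b :=
  rfl

/-- Right multiplication by `c ⊗ d` on the free bimodule of rank one. -/
def freeRightMul (k : Type u) [Field k] [Algebra k A] (c d : A) :
    freeBimodule k A ⟶ freeBimodule k A :=
  rightMul (c ⊗ₜ[k] MulOpposite.op d : Env k A)

theorem freeRightMul_freeMk (a b c d : A) :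
    (freeRightMul k c d).hom (freeMk k a b) = freeMk k (a * c) (d * b) :=
  Algebra.TensorProduct.tmul_mul_tmul _ _ _ _

/-- The action of `a ⊗ b` on a bimodule. -/
abbrev bimodLsmul (X : Bimod k A) (a b : A) : X →ₗ[k] X :=
  Algebra.lsmul k k X (a ⊗ₜ[k] MulOpposite.op b : Env k A)

/-- Over a field the tensor product of the two image inclusions stays injective, so the image of `f
⊗ g` is `im f ⊗ im g`. -/
theorem finrank_range_tensorProduct_map {V W : Type*} [AddCommGroup V] [Module k V]
    [AddCommGroup W] [Module k W] (f : V →ₗ[k] V) (g : W →ₗ[k] W) :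
    Module.finrank k (LinearMap.range (TensorProduct.map f g))
      = Module.finrank k (LinearMap.range f) * Module.finrank k (LinearMap.range g) := by
  have h : TensorProduct.map f g = TensorProduct.map (LinearMap.range f).subtype
      (LinearMap.range g).subtype ∘ₗ TensorProduct.map f.rangeRestrict g.rangeRestrict := by
    rw [← TensorProduct.map_comp]
    rfl
  have hsurj : Function.Surjective (TensorProduct.map f.rangeRestrict g.rangeRestrict) :=
    TensorProduct.map_surjective f.surjective_rangeRestrict g.surjective_rangeRestrict
  have hinj : Function.Injective (TensorProduct.map (LinearMap.range f).subtype
      (LinearMap.range g).subtype) := by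
    rw [← LinearMap.lTensor_comp_rTensor]
    exact (Module.Flat.lTensor_preserves_injective_linearMap _ (Submodule.injective_subtype _)).comp
      (Module.Flat.rTensor_preserves_injective_linearMap _ (Submodule.injective_subtype _))
  rw [h, finrank_range_comp_of_injective _ _ hinj, LinearMap.range_eq_top.2 hsurj, finrank_top,
    Module.finrank_tensorProduct]

/-- The functor `X ↦ (a ⊗ b) (K ⊗_A X)` on right multiplications of the free bimodule. -/
theorem finrank_range_cut_tensor_freeRightMul (a b c d : A) :
    Module.finrank k (LinearMap.range (((tensorBifunctor k A).obj K ⋙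
        cutFunctor k (a ⊗ₜ[k] MulOpposite.op b : Env k A)).map (freeRightMul k c d)).hom)
      = Module.finrank k (LinearMap.range (bimodLsmul K a c))
        * Module.finrank k (LinearMap.range (bimodLsmul (regularBimodule k A) d b)) := by
  refine (finrank_range_cutFunctor_map (k := k) (X := tensorFree K) _
    (((tensorBifunctor k A).obj K).map (freeRightMul k c d))).trans ?_
  rw [← finrank_range_tensorProduct_map]
  -- On `K ⊗ₖ A` the composite is `m ⊗ x ↦ a m c ⊗ d x b`.
  refine finrank_range_eq_of_conj (tensorFreeEquiv K) _ _ fun x => ?_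
  induction x using tensorFree_induction with
  | zero => simp only [map_zero]
  | add x y hx hy => rw [map_add, map_add, hx, hy, map_add, map_add]
  | mk m x =>
    have h1 : (((tensorBifunctor k A).obj K).map (freeRightMul k c d)).hom
        (tensorMk k A m (freeMk k 1 x)) = tensorMk k A m (freeMk k (1 * c) (d * x)) := by
      rw [← freeRightMul_freeMk]
      rfl
    have h2 : (a ⊗ₜ[k] MulOpposite.op b : Env k A) • tensorMk k A m (freeMk k (1 * c) (d * x))
        = tensorMk k A ((a ⊗ₜ[k] (1 : Aᵐᵒᵖ) : Env k A) • m)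
          (((1 : A) ⊗ₜ[k] MulOpposite.op b : Env k A) • freeMk k (1 * c) (d * x)) :=
      congrArg Submodule.Quotient.mk (outerAction_tmul k A K (freeBimodule k A) a _ m _)
    have h3 := (congrArg (fun z => (a ⊗ₜ[k] MulOpposite.op b : Env k A) • z) h1).trans h2
    refine (congrArg (tensorFreeEquiv K) h3).trans ?_
    rw [smul_freeMk, tensorFreeEquiv_tensorMk, tensorFreeEquiv_tensorMk, TensorProduct.map_tmul,
      Algebra.lsmul_coe, Algebra.lsmul_coe]
    beta_reduce
    rw [smul_regMk, smul_smul, smul_smul,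
      Algebra.TensorProduct.tmul_mul_tmul, Algebra.TensorProduct.tmul_mul_tmul]
    simp

theorem finiteDimensional_tensorFree [FiniteDimensional k A] [FiniteDimensional k K] :
    FiniteDimensional k (tensorFree K) := by
  have : FiniteDimensional k (regularBimodule k A) := Module.Finite.equiv (regularBimoduleEquiv k A)
  exact Module.Finite.equiv (tensorFreeEquiv K).symm

/-- The map `A ⊗ₖ (K ⊗ₖ A) → K`, `b ⊗ (m ⊗ x) ↦ x b m`, as a bilinear map. -/
def cyclicContract : A →ₗ[k] K ⊗[k] regularBimodule k A →ₗ[k] K :=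
  LinearMap.mk₂ k (fun b t => TensorProduct.lift ((Algebra.lsmul k k K).toLinearMap
      ∘ₗ (Algebra.TensorProduct.includeLeft (R := k) (S := k) (A := A) (B := Aᵐᵒᵖ)).toLinearMap
      ∘ₗ LinearMap.mulRight k b ∘ₗ (regularBimoduleEquiv k A).symm.toLinearMap).flip t)
    (fun b b' t => by
      induction t using TensorProduct.induction_on with
      | zero => simp
      | add x y hx hy => simp only [map_add, hx, hy]; abel
      | tmul m x => simp [mul_add, TensorProduct.add_tmul])
    (fun c b t => by
      induction t using TensorProduct.induction_on with
      | zero => simp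
      | add x y hx hy => simp only [map_add, hx, hy, smul_add]
      | tmul m x =>
        simp only [TensorProduct.lift.tmul, LinearMap.flip_apply, LinearMap.comp_apply, map_smul,
          LinearMap.mulRight_apply, mul_smul_comm, LinearMap.smul_apply])
    (fun b t t' => map_add _ t t')
    (fun c b t => map_smul _ c t)

theorem cyclicContract_tmul (b : A) (m : K) (x : A) :
    cyclicContract K b (m ⊗ₜ[k] regMk k x) = ((x * b) ⊗ₜ[k] (1 : Aᵐᵒᵖ) : Env k A) • m := rfl

/-- The map `A ⊗_{Aᵉ} (K ⊗_A Aᵉ) → K`. -/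
def envTensorFreeMap : EnvTensor k A (tensorFree K) →ₗ[k] K :=
  Submodule.liftQ _ (TensorProduct.lift ((cyclicContract K).compl₂
    (tensorFreeEquiv K).toLinearMap)) (by
    refine Submodule.span_le.2 ?_
    rintro _ ⟨b, a, a', v, rfl⟩
    rw [SetLike.mem_coe, LinearMap.mem_ker, map_sub, sub_eq_zero, TensorProduct.lift.tmul,
      TensorProduct.lift.tmul, LinearMap.compl₂_apply, LinearMap.compl₂_apply]
    induction v using tensorFree_induction with
    | zero => simp only [smul_zero, map_zero]
    | add x y hx hy => simp only [smul_add, map_add, hx, hy]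
    | mk m x =>
      -- Both sides of the balancing relation contract to `x a' b a m`.
      have h : (a ⊗ₜ[k] MulOpposite.op a' : Env k A) • tensorMk k A m (freeMk k 1 x)
          = tensorMk k A ((a ⊗ₜ[k] (1 : Aᵐᵒᵖ) : Env k A) • m)
            (((1 : A) ⊗ₜ[k] MulOpposite.op a' : Env k A) • freeMk k 1 x) :=
        congrArg Submodule.Quotient.mk (outerAction_tmul k A K (freeBimodule k A) a _ m _)
      refine Eq.trans ?_ (congrArg (fun v => cyclicContract K b (tensorFreeEquiv K v)) h).symm
      change cyclicContract K (a' * b * a) (tensorFreeEquiv K (tensorMk k A m (freeMk k 1 x)))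
        = cyclicContract K b (tensorFreeEquiv K _)
      rw [smul_freeMk, tensorFreeEquiv_tensorMk, tensorFreeEquiv_tensorMk, cyclicContract_tmul,
        cyclicContract_tmul, smul_smul, smul_smul, smul_smul,
        Algebra.TensorProduct.tmul_mul_tmul, Algebra.TensorProduct.tmul_mul_tmul,
        Algebra.TensorProduct.tmul_mul_tmul]
      simp [mul_assoc])

theorem envTensorFreeMap_mk (b : A) (m : K) (a x : A) :
    envTensorFreeMap K (Submodule.Quotient.mk (b ⊗ₜ[k] tensorMk k A m (freeMk k a x)))
      = ((x * b) ⊗ₜ[k] MulOpposite.op a : Env k A) • m := by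
  change cyclicContract K b (tensorFreeEquiv K (tensorMk k A m (freeMk k a x))) = _
  rw [tensorFreeEquiv_tensorMk, cyclicContract_tmul, smul_smul,
    Algebra.TensorProduct.tmul_mul_tmul, mul_one, one_mul]

/-- The map `K → A ⊗_{Aᵉ} (K ⊗_A Aᵉ)`, `m ↦ 1 ⊗ (m ⊗ 1)`. -/
def envTensorFreeInv : K →+ EnvTensor k A (tensorFree K) :=
  AddMonoidHom.mk' (fun m => Submodule.Quotient.mk
      ((1 : A) ⊗ₜ[k] (show tensorFree K from tensorMk k A m (freeMk k 1 1))))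
    fun m m' => by
      rw [tensorMk_add_left]
      exact congrArg Submodule.Quotient.mk (TensorProduct.tmul_add (R := k) (N := tensorFree K) _ _ _)

theorem smul_tensorMk_freeMk (a b c d : A) (m : K) :
    (a ⊗ₜ[k] MulOpposite.op b : Env k A) • tensorMk k A m (freeMk k c d)
      = tensorMk k A ((a ⊗ₜ[k] (1 : Aᵐᵒᵖ) : Env k A) • m) (freeMk k c (d * b)) := by
  refine Eq.trans (congrArg Submodule.Quotient.mk
    (outerAction_tmul k A K (freeBimodule k A) a _ m _)) ?_
  change tensorMk k A _ _ = _
  rw [smul_freeMk, one_mul]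

theorem envTensor_mk_smul {X : Bimod k A} (b a a' : A) (x : X) :
    (Submodule.Quotient.mk (b ⊗ₜ[k] ((a ⊗ₜ[k] MulOpposite.op a' : Env k A) • x)) : EnvTensor k A X)
      = Submodule.Quotient.mk ((a' * b * a) ⊗ₜ[k] x) := by
  have h : (a' * b * a) ⊗ₜ[k] x - b ⊗ₜ[k] ((a ⊗ₜ[k] MulOpposite.op a' : Env k A) • x)
      ∈ envBalancing k A X := Submodule.subset_span ⟨b, a, a', x, rfl⟩
  exact ((Submodule.Quotient.eq _).2 h).symm

/-- The class of `b ⊗ (m ⊗ (1 ⊗ x))` is that of `x b ⊗ (m ⊗ 1)`, hence of `1 ⊗ (x b m ⊗ 1)`. With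
surjectivity, a single composite identity yields the equivalence. -/
theorem envTensorFreeInv_surjective : Function.Surjective (envTensorFreeInv K) := by
  suffices h : ∀ u, u ∈ (envTensorFreeInv K).range from h
  intro u
  obtain ⟨u, rfl⟩ := Submodule.Quotient.mk_surjective _ u
  induction u using TensorProduct.induction_on with
  | zero => exact zero_mem _
  | add x y hx hy => exact add_mem hx hy
  | tmul b v =>
    induction v using tensorFree_induction with
    | zero =>
      rw [TensorProduct.tmul_zero]
      exact zero_mem _
    | add x y hx hy =>
      rw [TensorProduct.tmul_add]
      exact add_mem hx hy
    | mk m x =>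
      have h1 := smul_tensorMk_freeMk K 1 x 1 1 m
      have h2 := smul_tensorMk_freeMk K (x * b) 1 1 1 m
      rw [← Algebra.TensorProduct.one_def, one_smul, one_mul] at h1
      rw [one_mul] at h2
      refine ⟨((x * b) ⊗ₜ[k] (1 : Aᵐᵒᵖ) : Env k A) • m, ?_⟩
      refine (congrArg (fun v : tensorFree K =>
        (Submodule.Quotient.mk ((1 : A) ⊗ₜ[k] v) : EnvTensor k A (tensorFree K))) h2.symm).trans ?_
      refine Eq.trans ?_ (congrArg (fun v : tensorFree K =>
        (Submodule.Quotient.mk (b ⊗ₜ[k] v) : EnvTensor k A (tensorFree K))) h1)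
      refine (envTensor_mk_smul (X := tensorFree K) 1 (x * b) 1 _).trans
        (Eq.trans ?_ (envTensor_mk_smul (X := tensorFree K) b 1 x _).symm)
      rw [one_mul, one_mul, mul_one]

theorem envTensorFreeMap_inv (m : K) : envTensorFreeMap K (envTensorFreeInv K m) = m := by
  refine (envTensorFreeMap_mk K 1 m 1 1).trans ?_
  rw [one_mul, MulOpposite.op_one, ← Algebra.TensorProduct.one_def, one_smul]

/-- `A ⊗_{Aᵉ} (K ⊗_A Aᵉ)` is `K` as a vector space. -/
def envTensorFreeEquiv : EnvTensor k A (tensorFree K) ≃ₗ[k] K :=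
  { envTensorFreeMap K with
    invFun := envTensorFreeInv K
    left_inv := fun u => by
      obtain ⟨m, rfl⟩ := envTensorFreeInv_surjective K u
      exact congrArg _ (envTensorFreeMap_inv K m)
    right_inv := envTensorFreeMap_inv K }

/-- The functor `X ↦ A ⊗_{Aᵉ} (K ⊗_A X)` on right multiplications of the free bimodule. -/
theorem finrank_range_envTensor_tensor_freeRightMul (c d : A) :
    Module.finrank k (LinearMap.range (((tensorBifunctor k A).obj K ⋙
        envTensorFunctor k A).map (freeRightMul k c d)).hom)
      = Module.finrank k (LinearMap.range (bimodLsmul K d c)) := by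
  refine finrank_range_eq_of_conj (envTensorFreeEquiv K) _ _ fun u => ?_
  -- Transported to `K`, the map is `m ↦ d m c`: the right entry `d` travels round the cycle and
  -- acts from the left.
  obtain ⟨m, rfl⟩ := envTensorFreeInv_surjective K u
  have h1 : (((tensorBifunctor k A).obj K).map (freeRightMul k c d)).hom
      (tensorMk k A m (freeMk k 1 1)) = tensorMk k A m (freeMk k (1 * c) (d * 1)) := by
    rw [← freeRightMul_freeMk]
    rfl
  refine (congrArg (fun v : tensorFree K => envTensorFreeMap K
    (Submodule.Quotient.mk ((1 : A) ⊗ₜ[k] v))) h1).trans ?_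
  refine (envTensorFreeMap_mk K 1 m _ _).trans ?_
  refine Eq.trans ?_ (congrArg (bimodLsmul K d c) (envTensorFreeMap_inv K m)).symm
  rw [mul_one, mul_one, one_mul]
  rfl

end FreeBimodule

/-! ### Cartan matrices of tensor products with projectives -/

section CartanTensor

open scoped ModuleCat

variable {k A : Type u} [Field k] [Ring A] [Algebra k A] {r : ℕ}

theorem cartanMatrixAlgebra_apply' (e : Fin r → A) (i j : Fin r) :
    cartanMatrixAlgebra k e i j
      = Module.finrank k (LinearMap.range (bimodLsmul (regularBimodule k A) (e j) (e i))) := rfl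

/-- Since the second factor is opposite, `(a ⊗ b) Aᵉ (c ⊗ d)` is `a A c ⊗ d A b`. -/
theorem finrank_range_cutFunctor_map_rightMul_env (a b c d : A) :
    Module.finrank k (LinearMap.range ((cutFunctor k (a ⊗ₜ[k] MulOpposite.op b : Env k A)).map
        (rightMul (c ⊗ₜ[k] MulOpposite.op d : Env k A))).hom)
      = Module.finrank k (LinearMap.range (LinearMap.mulLeftRight k (a, c)))
        * Module.finrank k (LinearMap.range (LinearMap.mulLeftRight k (d, b))) := by
  rw [finrank_range_cutFunctor_map_rightMul]
  have h1 : LinearMap.mulLeftRight k ((a ⊗ₜ[k] MulOpposite.op b : Env k A),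
      (c ⊗ₜ[k] MulOpposite.op d : Env k A)) = TensorProduct.map (LinearMap.mulLeftRight k (a, c))
      (LinearMap.mulLeftRight k (MulOpposite.op b, MulOpposite.op d)) := by
    apply TensorProduct.ext'
    intro x y
    simp [LinearMap.mulLeftRight_apply, Algebra.TensorProduct.tmul_mul_tmul]
  have h2 : Module.finrank k (LinearMap.range
      (LinearMap.mulLeftRight k (MulOpposite.op b, MulOpposite.op d)))
      = Module.finrank k (LinearMap.range (LinearMap.mulLeftRight k (d, b))) :=
    finrank_range_eq_of_conj (MulOpposite.opLinearEquiv k).symm _ _ fun x => by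
      simp [LinearMap.mulLeftRight_apply, mul_assoc]
  rw [h1, finrank_range_tensorProduct_map, h2]

variable [FiniteDimensional k A] {e : Fin r → A} {π : Env k A →ₐ[k] (Fin r × Fin r → k)}

/-- The multiplicities of a finitely generated projective bimodule, arranged as a matrix `N`,
determine its Cartan matrix and those of its tensor products. -/
theorem exists_multiplicityMatrix (h : IsSplitBasic (envIdempotent k e) π) (Q : Bimod k A)
    [Module.Finite (Env k A) Q] [Module.Projective (Env k A) Q] :
    ∃ N : Matrix (Fin r) (Fin r) ℤ,
      cartanMatrix e Q = cartanMatrixAlgebra k e * N * cartanMatrixAlgebra k e ∧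
      ∀ K : Bimod k A, FiniteDimensional k K →
        FiniteDimensional k (((tensorBifunctor k A).obj K).obj Q) ∧
        cartanMatrix e (((tensorBifunctor k A).obj K).obj Q)
          = cartanMatrixAlgebra k e * N * cartanMatrix e K ∧
        FiniteDimensional k ((envTensorFunctor k A).obj (((tensorBifunctor k A).obj K).obj Q)) ∧
        (Module.finrank k ((envTensorFunctor k A).obj (((tensorBifunctor k A).obj K).obj Q)) : ℤ)
          = (N * cartanMatrix e K).trace := by
  obtain ⟨N, hN⟩ := h.exists_multiplicity Q
  -- `N (c, d)` counts copies of `A e_c ⊗ e_d A`, whose `e_j _ e_i` has dimension `C i d * C c j`.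
  -- Transposing the indices makes the sum a matrix product.
  refine ⟨Matrix.of fun d c => (N (c, d) : ℤ), ?_, fun K hK => ⟨?_, ?_, ?_, ?_⟩⟩
  · ext i j
    have hfin : FiniteDimensional k
        ((cutFunctor k (envIdempotent k e (j, i))).obj (ModuleCat.of (Env k A) (Env k A))) :=
      finiteDimensional_cutFunctor _ _
    have hd := (hN (cutFunctor k (envIdempotent k e (j, i))) hfin).2
    have hd' := hd.trans (Finset.sum_congr rfl fun p _ => congrArg (N p * ·)
      (finrank_range_cutFunctor_map_rightMul_env (e j) (e i) (e p.1) (e p.2)))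
    refine (congrArg (Nat.cast : ℕ → ℤ) hd').trans ?_
    push_cast
    simp only [← cartanMatrixAlgebra_apply, Matrix.mul_apply, Matrix.of_apply, Finset.sum_mul,
      Fintype.sum_prod_type]
    exact Finset.sum_congr rfl fun c _ => Finset.sum_congr rfl fun d _ => by ring
  -- Cutting by `1` recovers the underlying vector space, so the multiplicity statement also gives
  -- finite dimensionality.
  · have hfin : FiniteDimensional k (((tensorBifunctor k A).obj K ⋙
        cutFunctor k (1 : Env k A)).obj (ModuleCat.of (Env k A) (Env k A))) := by
      have := finiteDimensional_tensorFree K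
      exact inferInstanceAs (FiniteDimensional k (LinearMap.range
        (Algebra.lsmul k k (tensorFree K) (1 : Env k A))))
    have h1 := (hN ((tensorBifunctor k A).obj K ⋙ cutFunctor k (1 : Env k A)) hfin).1
    have h2 : FiniteDimensional k (LinearMap.range (Algebra.lsmul k k
      (((tensorBifunctor k A).obj K).obj Q) (1 : Env k A))) := h1
    rw [map_one, LinearMap.range_eq_top.2 fun x => ⟨x, rfl⟩] at h2
    exact Module.Finite.equiv Submodule.topEquiv
  · ext i j
    have hfin : FiniteDimensional k (((tensorBifunctor k A).obj K ⋙
        cutFunctor k (envIdempotent k e (j, i))).obj (ModuleCat.of (Env k A) (Env k A))) := by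
      have := finiteDimensional_tensorFree K
      exact inferInstanceAs (FiniteDimensional k (LinearMap.range
        (Algebra.lsmul k k (tensorFree K) (envIdempotent k e (j, i)))))
    have hd := (hN ((tensorBifunctor k A).obj K ⋙ cutFunctor k (envIdempotent k e (j, i))) hfin).2
    have hd' := hd.trans (Finset.sum_congr rfl fun p _ => congrArg (N p * ·)
      (finrank_range_cut_tensor_freeRightMul K (e j) (e i) (e p.1) (e p.2)))
    refine (congrArg (Nat.cast : ℕ → ℤ) hd').trans ?_
    push_cast
    simp only [Matrix.mul_apply, Matrix.of_apply, Finset.sum_mul, Fintype.sum_prod_type]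
    exact Finset.sum_congr rfl fun c _ => Finset.sum_congr rfl fun d _ => by
      rw [cartanMatrixAlgebra_apply']
      change _ = _ * _ * ((Module.finrank k (LinearMap.range (bimodLsmul K (e j) (e c))) : ℕ) : ℤ)
      ring
  · have hfin : FiniteDimensional k (((tensorBifunctor k A).obj K ⋙
        envTensorFunctor k A).obj (ModuleCat.of (Env k A) (Env k A))) :=
      Module.Finite.equiv (envTensorFreeEquiv K).symm
    exact (hN ((tensorBifunctor k A).obj K ⋙ envTensorFunctor k A) hfin).1
  · have hfin : FiniteDimensional k (((tensorBifunctor k A).obj K ⋙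
        envTensorFunctor k A).obj (ModuleCat.of (Env k A) (Env k A))) :=
      Module.Finite.equiv (envTensorFreeEquiv K).symm
    have hd := (hN ((tensorBifunctor k A).obj K ⋙ envTensorFunctor k A) hfin).2
    have hd' := hd.trans (Finset.sum_congr rfl fun p _ => congrArg (N p * ·)
      (finrank_range_envTensor_tensor_freeRightMul K (e p.1) (e p.2)))
    refine (congrArg (Nat.cast : ℕ → ℤ) hd').trans ?_
    push_cast
    simp only [Matrix.trace, Matrix.diag, Matrix.mul_apply, Matrix.of_apply, Fintype.sum_prod_type]
    rw [Finset.sum_comm]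
    rfl

end CartanTensor

/-! ### Tensor powers of complexes -/

section TotalComplex

open scoped ModuleCat Pointwise

variable {k A : Type u} [Field k] [Ring A] [Algebra k A]

theorem tensorObj_isZero_left {X : Bimod k A} (hX : Limits.IsZero X) (Y : Bimod k A) :
    Limits.IsZero (((tensorBifunctor k A).obj X).obj Y) :=
  ((tensorBifunctor k A).flip.obj Y).map_isZero hX

variable (K L : CochainComplex (Bimod k A) ℤ)

/-- The inclusion of a summand of a term of the tensor product of two complexes. -/
def tensorInc (n p : ℤ) : ((tensorBifunctor k A).obj (K.X p)).obj (L.X (n - p)) ⟶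
    (tensorComplex K L).X n :=
  HomologicalComplex.ιMapBifunctor K L (tensorBifunctor k A) (ComplexShape.up ℤ) p (n - p) n
    (add_sub_cancel p n)

/-- The projection to a summand of a term of the tensor product of two complexes. -/
def tensorProj (n p : ℤ) : (tensorComplex K L).X n ⟶
    ((tensorBifunctor k A).obj (K.X p)).obj (L.X (n - p)) :=
  HomologicalComplex.mapBifunctorDesc fun p' q' h =>
    if hp : p' = p then eqToHom (by
      have h' : p' + q' = n := h
      have hq : q' = n - p := by omega
      rw [hp, hq]) else 0

theorem tensorInc_tensorProj_same (n p : ℤ) :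
    tensorInc K L n p ≫ tensorProj K L n p = 𝟙 _ := by
  refine (HomologicalComplex.ι_mapBifunctorDesc (K₁ := K) (K₂ := L) (F := tensorBifunctor k A)
    (c := ComplexShape.up ℤ) _ p (n - p) _).trans ?_
  rw [dif_pos rfl, eqToHom_refl]

theorem tensorInc_tensorProj_ne (n : ℤ) {p p' : ℤ} (h : p ≠ p') :
    tensorInc K L n p ≫ tensorProj K L n p' = 0 := by
  refine (HomologicalComplex.ι_mapBifunctorDesc (K₁ := K) (K₂ := L) (F := tensorBifunctor k A)
    (c := ComplexShape.up ℤ) _ p (n - p) _).trans ?_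
  rw [dif_neg h]

/-- Boundedness of the first complex alone reduces the coproduct over `p + q = n` to a finite direct
sum. -/
theorem sum_tensorProj_tensorInc (s : Finset ℤ) (hs : ∀ p ∉ s, Limits.IsZero (K.X p)) (n : ℤ) :
    ∑ p : s, tensorProj K L n p ≫ tensorInc K L n p = 𝟙 _ := by
  refine HomologicalComplex.mapBifunctor.hom_ext fun p q h => ?_
  have h' : p + q = n := h
  obtain rfl : q = n - p := by omega
  by_cases hp : p ∈ s
  · change tensorInc K L n p ≫ _ = tensorInc K L n p ≫ _
    rw [Preadditive.comp_sum, Finset.sum_eq_single ⟨p, hp⟩, Category.comp_id, ← Category.assoc,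
      tensorInc_tensorProj_same, Category.id_comp]
    · intro p' _ hne
      rw [← Category.assoc, tensorInc_tensorProj_ne K L n fun h => hne (Subtype.ext h.symm),
        Limits.zero_comp]
    · simp
  · exact (tensorObj_isZero_left (hs p hp) _).eq_of_src _ _

/-- An additive functor turns the terms of a tensor product of complexes, the first of which is
bounded, into finite products. -/
def mapTensorComplexEquiv (F : Bimod k A ⥤ ModuleCat.{u} k) [F.Additive] (s : Finset ℤ)
    (hs : ∀ p ∉ s, Limits.IsZero (K.X p)) (n : ℤ) : F.obj ((tensorComplex K L).X n) ≃ₗ[k]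
      (∀ p : s, F.obj (((tensorBifunctor k A).obj (K.X p)).obj (L.X (n - p)))) :=
  mapDecompositionEquiv F (fun p : s => tensorInc K L n p) (fun p => tensorProj K L n p)
    (fun p => tensorInc_tensorProj_same K L n p)
    (fun _ _ h => tensorInc_tensorProj_ne K L n fun h' => h (Subtype.ext h'))
    (sum_tensorProj_tensorInc K L s hs n)

theorem finrank_map_tensorComplex (F : Bimod k A ⥤ ModuleCat.{u} k) [F.Additive] (s : Finset ℤ)
    (hs : ∀ p ∉ s, Limits.IsZero (K.X p)) (n : ℤ)
    (hfin : ∀ p, FiniteDimensional k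
      (F.obj (((tensorBifunctor k A).obj (K.X p)).obj (L.X (n - p))))) :
    FiniteDimensional k (F.obj ((tensorComplex K L).X n)) ∧
      Module.finrank k (F.obj ((tensorComplex K L).X n)) = ∑ p ∈ s,
        Module.finrank k (F.obj (((tensorBifunctor k A).obj (K.X p)).obj (L.X (n - p)))) := by
  have φ := mapTensorComplexEquiv K L F s hs n
  refine ⟨Module.Finite.equiv φ.symm, ?_⟩
  rw [φ.finrank_eq, Module.finrank_pi_fintype, Finset.sum_coe_sort s fun p =>
    Module.finrank k (F.obj (((tensorBifunctor k A).obj (K.X p)).obj (L.X (n - p))))]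

theorem tensorComplex_X_isZero (s t : Finset ℤ) (hs : ∀ p ∉ s, Limits.IsZero (K.X p))
    (ht : ∀ q ∉ t, Limits.IsZero (L.X q)) {n : ℤ} (hn : ∀ p ∈ s, n - p ∉ t) :
    Limits.IsZero ((tensorComplex K L).X n) := by
  rw [Limits.IsZero.iff_id_eq_zero, ← sum_tensorProj_tensorInc K L s hs n]
  refine Finset.sum_eq_zero fun p _ => ?_
  have h0 : Limits.IsZero (((tensorBifunctor k A).obj (K.X p)).obj (L.X (n - p))) :=
    ((tensorBifunctor k A).obj (K.X p)).map_isZero (ht _ (hn p p.2))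
  rw [h0.eq_of_src (tensorInc K L n p) 0, Limits.comp_zero]

/-- A complex is bounded if almost all of its terms vanish. -/
def IsBoundedComplex {𝒞 : Type*} [Category 𝒞] [Limits.HasZeroMorphisms 𝒞]
    (K : CochainComplex 𝒞 ℤ) : Prop :=
  {i : ℤ | ¬ Limits.IsZero (K.X i)}.Finite

theorem IsBoundedComplex.isZero {𝒞 : Type*} [Category 𝒞] [Limits.HasZeroMorphisms 𝒞]
    {K : CochainComplex 𝒞 ℤ} (hK : IsBoundedComplex K) :
    ∀ p ∉ Set.Finite.toFinset hK, Limits.IsZero (K.X p) := fun _ hp =>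
  by_contra fun h => hp ((Set.Finite.mem_toFinset hK).2 h)

variable {K L}

theorem IsBoundedComplex.tensorComplex (hK : IsBoundedComplex K) (hL : IsBoundedComplex L) :
    IsBoundedComplex (tensorComplex K L) := by
  have hs := hK.isZero
  have ht := hL.isZero
  refine ((Finset.finite_toSet (Set.Finite.toFinset hK)).add (Finset.finite_toSet (Set.Finite.toFinset hL))).subset ?_
  intro n hn
  by_contra h
  refine hn (tensorComplex_X_isZero K L _ _ hs ht fun p hp hnp => h ?_)
  exact ⟨p, hp, n - p, hnp, add_sub_cancel p n⟩

theorem IsBoundedComplex.map {𝒞 𝒟 : Type*} [Category 𝒞] [Category 𝒟] [Preadditive 𝒞]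
    [Preadditive 𝒟] {K : CochainComplex 𝒞 ℤ} (hK : IsBoundedComplex K) (F : 𝒞 ⥤ 𝒟) [F.Additive] :
    IsBoundedComplex ((F.mapHomologicalComplex (ComplexShape.up ℤ)).obj K) :=
  hK.subset fun _ hi hz => hi (F.map_isZero hz)

/-- The Euler characteristic of a convolution. -/
theorem altSum_convolution {X : Type*} [Fintype X] (s t : Finset ℤ) (w : X → ℤ) (f g : X → ℤ → ℤ)
    (hf : ∀ x, ∀ l ∉ s, f x l = 0) (hg : ∀ x, ∀ l ∉ t, g x l = 0) :
    altSum (fun n => ∑ p ∈ s, ∑ x, w x * f x p * g x (n - p))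
      = ∑ x, w x * altSum (f x) * altSum (g x) := by
  classical
  -- For fixed `p` the sum over `n` is a translated copy of the alternating sum of `g x`. The index
  -- `x`, weighted by `w`, will run over summation indices of matrix products.
  have hshift : ∀ x p, p ∈ s → ∑ n ∈ s + t, (n.negOnePow : ℤ) * g x (n - p)
      = (p.negOnePow : ℤ) * altSum (g x) := by
    intro x p hp
    have h1 : altSum (fun n => g x (n - p)) = ∑ n ∈ s + t, (n.negOnePow : ℤ) * g x (n - p) := by
      refine altSum_eq_sum (s + t) fun n hn => hg x _ fun hnp => hn ?_
      exact Finset.mem_add.2 ⟨p, hp, n - p, hnp, add_sub_cancel p n⟩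
    rw [← h1, altSum, ← finsum_comp_equiv (Equiv.addRight p), altSum, mul_finsum]
    refine finsum_congr fun l => ?_
    simp [Int.negOnePow_add]
    ring
  rw [altSum_eq_sum (s + t)]
  · simp only [Finset.mul_sum]
    rw [Finset.sum_comm]
    have : ∀ p ∈ s, ∑ n ∈ s + t, ∑ x, (n.negOnePow : ℤ) * (w x * f x p * g x (n - p))
        = ∑ x, w x * ((p.negOnePow : ℤ) * f x p) * altSum (g x) := by
      intro p hp
      rw [Finset.sum_comm]
      refine Finset.sum_congr rfl fun x _ => ?_
      have := hshift x p hp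
      calc ∑ n ∈ s + t, (n.negOnePow : ℤ) * (w x * f x p * g x (n - p))
          = w x * f x p * ∑ n ∈ s + t, (n.negOnePow : ℤ) * g x (n - p) := by
            rw [Finset.mul_sum]
            exact Finset.sum_congr rfl fun n _ => by ring
        _ = _ := by rw [this]; ring
    rw [Finset.sum_congr rfl this, Finset.sum_comm]
    refine Finset.sum_congr rfl fun x _ => ?_
    rw [altSum_eq_sum s (hf x), Finset.mul_sum, Finset.sum_mul]
  · intro n hn
    refine Finset.sum_eq_zero fun p hp => Finset.sum_eq_zero fun x _ => ?_
    rw [hg x (n - p) fun h => hn (Finset.mem_add.2 ⟨p, hp, n - p, h, add_sub_cancel p n⟩), mul_zero]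

end TotalComplex

/-! ### Euler matrices of tensor products -/

section EulerMatrix

open scoped ModuleCat

variable {k A : Type u} [Field k] [Ring A] [Algebra k A] {r : ℕ}

/-- The alternating sum of the Cartan matrices of the terms of a complex. -/
def eulerMatrix (e : Fin r → A) (K : CochainComplex (Bimod k A) ℤ) : Matrix (Fin r) (Fin r) ℤ :=
  Matrix.of fun i j => altSum fun l => cartanMatrix e (K.X l) i j

theorem cartanMatrix_eq_zero {e : Fin r → A} {X : Bimod k A} (h : Limits.IsZero X) :
    cartanMatrix e X = 0 := by
  ext i j
  rw [cartanMatrix_apply, finrank_eq_zero_of_isZero ((cutFunctor k _).map_isZero h)]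
  rfl

variable [FiniteDimensional k A] {e : Fin r → A} {π : Env k A →ₐ[k] (Fin r × Fin r → k)}
  {K P : CochainComplex (Bimod k A) ℤ}

/-- Tensoring with a perfect complex keeps bounded complexes of finite-dimensional bimodules, and
multiplies Euler matrices. -/
theorem eulerMatrix_tensorComplex (h : IsSplitBasic (envIdempotent k e) π)
    (hC : IsUnit (cartanMatrixAlgebra k e).det) (hK : IsBoundedComplex K)
    (hKfin : ∀ i, FiniteDimensional k (K.X i)) (hP : IsBoundedComplex P)
    (hPfin : ∀ i, Module.Finite (Env k A) (P.X i))
    (hPproj : ∀ i, Module.Projective (Env k A) (P.X i)) :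
    (∀ i, FiniteDimensional k ((tensorComplex K P).X i)) ∧
    eulerMatrix e (tensorComplex K P)
      = eulerMatrix e P * (cartanMatrixAlgebra k e)⁻¹ * eulerMatrix e K ∧
    (∀ i, FiniteDimensional k ((envTensorComplex (tensorComplex K P)).X i)) ∧
    altSum (fun i => Module.finrank k ((envTensorComplex (tensorComplex K P)).X i))
      = (eulerMatrix e P * (cartanMatrixAlgebra k e)⁻¹ * eulerMatrix e K
          * (cartanMatrixAlgebra k e)⁻¹).trace := by
  set C := cartanMatrixAlgebra k e with hCdef
  have hs := hK.isZero
  have ht := hP.isZero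
  have key : ∀ p q,
      FiniteDimensional k (((tensorBifunctor k A).obj (K.X p)).obj (P.X q)) ∧
      cartanMatrix e (((tensorBifunctor k A).obj (K.X p)).obj (P.X q))
        = cartanMatrix e (P.X q) * C⁻¹ * cartanMatrix e (K.X p) ∧
      FiniteDimensional k
        ((envTensorFunctor k A).obj (((tensorBifunctor k A).obj (K.X p)).obj (P.X q))) ∧
      (Module.finrank k
        ((envTensorFunctor k A).obj (((tensorBifunctor k A).obj (K.X p)).obj (P.X q))) : ℤ)
        = (cartanMatrix e (P.X q) * C⁻¹ * cartanMatrix e (K.X p) * C⁻¹).trace := by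
    intro p q
    obtain ⟨N, hN, hN'⟩ := exists_multiplicityMatrix h (P.X q)
    obtain ⟨h1, h2, h3, h4⟩ := hN' (K.X p) (hKfin p)
    -- Invertibility of `C` eliminates the multiplicity matrix, leaving expressions linear in the
    -- Cartan matrix of `P.X q`, which can be summed with signs over `q`.
    have hPC : cartanMatrix e (P.X q) * C⁻¹ = C * N := by
      rw [hN, Matrix.mul_assoc, Matrix.mul_nonsing_inv _ hC, Matrix.mul_one]
    refine ⟨h1, ?_, h3, ?_⟩
    · rw [h2, hPC]
    · rw [h4, hPC, Matrix.trace_mul_comm (C * N * _) C⁻¹, Matrix.mul_assoc C, ← Matrix.mul_assoc,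
        Matrix.nonsing_inv_mul _ hC, Matrix.one_mul]
  refine ⟨fun n => ?_, ?_, fun n => ?_, ?_⟩
  · have h1 := (finrank_map_tensorComplex K P (cutFunctor k (1 : Env k A)) _ hs n fun p => by
      have := (key p (n - p)).1
      exact inferInstanceAs (FiniteDimensional k (LinearMap.range (Algebra.lsmul k k
        (((tensorBifunctor k A).obj (K.X p)).obj (P.X (n - p))) (1 : Env k A))))).1
    have h2 : FiniteDimensional k (LinearMap.range (Algebra.lsmul k k
      ((tensorComplex K P).X n) (1 : Env k A))) := h1
    rw [map_one, LinearMap.range_eq_top.2 fun x => ⟨x, rfl⟩] at h2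
    exact Module.Finite.equiv Submodule.topEquiv
  · ext i j
    have hterm : ∀ n, cartanMatrix e ((tensorComplex K P).X n) i j
        = ∑ p ∈ (Set.Finite.toFinset hK), ∑ x : Fin r × Fin r, C⁻¹ x.1 x.2
          * cartanMatrix e (K.X p) x.2 j * cartanMatrix e (P.X (n - p)) i x.1 := by
      intro n
      have h1 := (finrank_map_tensorComplex K P (cutFunctor k (envIdempotent k e (j, i))) _ hs n
        fun p => by
          have := (key p (n - p)).1
          exact inferInstanceAs (FiniteDimensional k (LinearMap.range (Algebra.lsmul k k
            (((tensorBifunctor k A).obj (K.X p)).obj (P.X (n - p)))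
            (envIdempotent k e (j, i)))))).2
      rw [cartanMatrix_apply, h1]
      push_cast
      refine Finset.sum_congr rfl fun p _ => ?_
      rw [← cartanMatrix_apply, (key p (n - p)).2.1, Fintype.sum_prod_type_right]
      simp only [Matrix.mul_apply, Finset.sum_mul]
      exact Finset.sum_congr rfl fun c _ => Finset.sum_congr rfl fun d _ => by ring
    simp only [eulerMatrix, Matrix.of_apply, hterm]
    rw [altSum_convolution _ (Set.Finite.toFinset hP) (fun x : Fin r × Fin r => C⁻¹ x.1 x.2)
      (fun x p => cartanMatrix e (K.X p) x.2 j) (fun x q => cartanMatrix e (P.X q) i x.1)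
      (fun x l hl => by rw [cartanMatrix_eq_zero (hs l hl)]; rfl)
      (fun x l hl => by rw [cartanMatrix_eq_zero (ht l hl)]; rfl), Fintype.sum_prod_type_right]
    simp only [Matrix.mul_apply, Finset.sum_mul, Matrix.of_apply]
    exact Finset.sum_congr rfl fun c _ => Finset.sum_congr rfl fun d _ => by ring
  · exact (finrank_map_tensorComplex K P (envTensorFunctor k A) _ hs n
      fun p => (key p (n - p)).2.2.1).1
  -- The quadruple `x` lists the four indices of the trace of a product of four matrices; the weight
  -- collects the two entries of `C⁻¹`.
  · have hterm : ∀ n, (Module.finrank k ((envTensorComplex (tensorComplex K P)).X n) : ℤ)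
        = ∑ p ∈ (Set.Finite.toFinset hK), ∑ x : Fin r × Fin r × Fin r × Fin r,
          (C⁻¹ x.2.2.2 x.2.2.1 * C⁻¹ x.2.1 x.1)
          * cartanMatrix e (K.X p) x.2.2.1 x.2.1 * cartanMatrix e (P.X (n - p)) x.1 x.2.2.2 := by
      intro n
      have h1 := (finrank_map_tensorComplex K P (envTensorFunctor k A) _ hs n
        fun p => (key p (n - p)).2.2.1).2
      refine (congrArg (Nat.cast : ℕ → ℤ) h1).trans ?_
      push_cast
      refine Finset.sum_congr rfl fun p _ => ?_
      rw [(key p (n - p)).2.2.2]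
      simp only [Matrix.trace, Matrix.diag, Matrix.mul_apply, Finset.sum_mul,
        Fintype.sum_prod_type]
      exact Finset.sum_congr rfl fun a _ => Finset.sum_congr rfl fun b _ =>
        Finset.sum_congr rfl fun c _ => Finset.sum_congr rfl fun d _ => by ring
    simp only [hterm]
    rw [altSum_convolution _ (Set.Finite.toFinset hP)
      (fun x : Fin r × Fin r × Fin r × Fin r => C⁻¹ x.2.2.2 x.2.2.1 * C⁻¹ x.2.1 x.1)
      (fun x p => cartanMatrix e (K.X p) x.2.2.1 x.2.1)
      (fun x q => cartanMatrix e (P.X q) x.1 x.2.2.2)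
      (fun x l hl => by rw [cartanMatrix_eq_zero (hs l hl)]; rfl)
      (fun x l hl => by rw [cartanMatrix_eq_zero (ht l hl)]; rfl)]
    simp only [Matrix.trace, Matrix.diag, Matrix.mul_apply, Finset.sum_mul, eulerMatrix,
      Matrix.of_apply, Fintype.sum_prod_type]
    exact Finset.sum_congr rfl fun a _ => Finset.sum_congr rfl fun b _ =>
      Finset.sum_congr rfl fun c _ => Finset.sum_congr rfl fun d _ => by ring

end EulerMatrix

/-! ### Growth of the traces of the powers of a matrix -/

section Growth

open Filter Module Module.End

/-- `f ^ n - c ^ n` is a multiple of the nilpotent `f - c` by a commuting factor, hence nilpotent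
and of trace zero. -/
theorem trace_pow_of_isNilpotent_sub {K V : Type*} [Field K] [AddCommGroup V] [Module K V]
    [FiniteDimensional K V] (f : Module.End K V) (c : K)
    (hf : IsNilpotent (f - algebraMap K (Module.End K V) c)) (n : ℕ) :
    LinearMap.trace K V (f ^ n) = finrank K V * c ^ n := by
  have hc : Commute f (algebraMap K (Module.End K V) c) := Algebra.commutes' c f |>.symm
  obtain ⟨g, hg⟩ := hc.sub_dvd_pow_sub_pow n
  have hnil : IsNilpotent (f ^ n - algebraMap K (Module.End K V) c ^ n) := by
    obtain ⟨m, hm⟩ := hf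
    have h1 : f ^ n - algebraMap K (Module.End K V) c ^ n
        = (∑ i ∈ Finset.range n, f ^ i * algebraMap K (Module.End K V) c ^ (n - 1 - i))
          * (f - algebraMap K (Module.End K V) c) := (hc.geom_sum₂_mul n).symm
    have h2 : Commute
        (∑ i ∈ Finset.range n, f ^ i * algebraMap K (Module.End K V) c ^ (n - 1 - i))
        (f - algebraMap K (Module.End K V) c) := by
      refine Commute.sum_left _ _ _ fun i _ => ?_
      refine Commute.mul_left ?_ ?_
      · exact ((Commute.refl f).sub_right hc).pow_left i
      · exact (hc.symm.sub_right (Commute.refl _)).pow_left _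
    rw [h1]
    exact ⟨m, by rw [h2.mul_pow, hm, mul_zero]⟩
  have h0 := (LinearMap.isNilpotent_trace_of_isNilpotent hnil).eq_zero
  rw [map_sub, sub_eq_zero] at h0
  rw [h0, ← map_pow, Algebra.algebraMap_eq_smul_one, map_smul, smul_eq_mul, mul_comm]
  congr 1
  exact LinearMap.trace_one K V

/-- Over an algebraically closed field the traces of the powers of an endomorphism are power sums
with positive multiplicities, in which every eigenvalue occurs. -/
theorem exists_trace_pow_eq_sum {K V : Type*} [Field K] [IsAlgClosed K] [AddCommGroup V]
    [Module K V] [FiniteDimensional K V] (f : Module.End K V) :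
    ∃ (s : Finset K) (d : K → ℕ), (∀ c ∈ s, 0 < d c) ∧ spectrum K f ⊆ s ∧
      ∀ n : ℕ, LinearMap.trace K V (f ^ n) = ∑ c ∈ s, (d c : K) * c ^ n := by
  classical
  have hind := f.independent_maxGenEigenspace
  have hfin : {c | f.maxGenEigenspace c ≠ ⊥}.Finite := WellFoundedGT.finite_ne_bot_of_iSupIndep hind
  -- The trace is summed over the nonzero generalized eigenspaces, whose dimensions are the
  -- multiplicities.
  have hint : DirectSum.IsInternal (fun c : hfin.toFinset => f.maxGenEigenspace (c : K)) := by
    rw [DirectSum.isInternal_submodule_iff_iSupIndep_and_iSup_eq_top]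
    refine ⟨hind.comp Subtype.val_injective, ?_⟩
    rw [eq_top_iff, ← f.iSup_maxGenEigenspace_eq_top]
    refine iSup_le fun c => ?_
    by_cases hc : f.maxGenEigenspace c = ⊥
    · simp [hc]
    · exact le_iSup (fun c : hfin.toFinset => f.maxGenEigenspace (c : K))
        ⟨c, by simpa using hc⟩
  refine ⟨hfin.toFinset, fun c => finrank K (f.maxGenEigenspace c), fun c hc => ?_,
    fun c hc => ?_, fun n => ?_⟩
  · rw [Set.Finite.mem_toFinset] at hc
    rw [Nat.pos_iff_ne_zero, Ne, Submodule.finrank_eq_zero]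
    exact hc
  · simp only [Set.Finite.coe_toFinset, Set.mem_ofPred_eq]
    have h1 : f.HasEigenvalue c := hasEigenvalue_iff_mem_spectrum.2 hc
    intro h
    refine h1 (eq_bot_iff.2 ?_)
    rw [← h]
    exact (f.genEigenspace c).monotone le_top
  · have hmaps : ∀ c : K, Set.MapsTo f (f.maxGenEigenspace c) (f.maxGenEigenspace c) :=
      fun c => mapsTo_maxGenEigenspace_of_comm (Commute.refl f) c
    have hmaps' : ∀ c : K, Set.MapsTo (f ^ n) (f.maxGenEigenspace c) (f.maxGenEigenspace c) :=
      fun c => mapsTo_maxGenEigenspace_of_comm ((Commute.refl f).pow_right n) c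
    rw [LinearMap.trace_eq_sum_trace_restrict hint fun c => hmaps' c,
      ← Finset.sum_coe_sort hfin.toFinset fun c => (finrank K (f.maxGenEigenspace c) : K) * c ^ n]
    refine Finset.sum_congr rfl fun c _ => ?_
    have hpow : (f ^ n).restrict (hmaps' c) = (f.restrict (hmaps c)) ^ n :=
      (Module.End.pow_restrict (f' := f) n (hmaps c) (hmaps' c)).symm
    rw [hpow]
    refine trace_pow_of_isNilpotent_sub (f.restrict (hmaps c)) (c : K) ?_ n
    exact f.isNilpotent_restrict_maxGenEigenspace_sub_algebraMap (c : K)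

/-- Finitely many complex numbers of modulus one have arbitrarily large common powers with real
parts at least `1 / 2`. -/
theorem exists_pow_re_ge {ι : Type*} [Fintype ι] (v : ι → ℂ) (hv : ∀ i, ‖v i‖ = 1) (N : ℕ) :
    ∃ n ≥ N, ∀ i, 1 / 2 ≤ (v i ^ n).re := by
  have hmem : ∀ n : ℕ, (fun i => v i ^ n) ∈ Metric.closedBall (0 : ι → ℂ) 1 := by
    intro n
    rw [mem_closedBall_zero_iff, pi_norm_le_iff_of_nonneg zero_le_one]
    intro i
    simp [hv i]
  -- Two late terms of a convergent subsequence of powers are close; as all `v i` have modulus one,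
  -- the power by the difference of the exponents is close to `1`. Strict monotonicity of `φ` makes
  -- that difference at least `N`.
  obtain ⟨a, -, φ, hφ, ha⟩ := (isCompact_closedBall (0 : ι → ℂ) 1).tendsto_subseq hmem
  obtain ⟨m, hm⟩ := Metric.cauchySeq_iff'.1 ha.cauchySeq (1 / 2) (by norm_num)
  have hle : N ≤ φ (m + N) - φ m := by
    have := StrictMono.add_le_nat hφ N m
    rw [add_comm m N]; omega
  refine ⟨φ (m + N) - φ m, hle, fun i => ?_⟩
  have h1 : dist (v i ^ φ (m + N)) (v i ^ φ m) < 1 / 2 :=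
    (dist_le_pi_dist (fun i => v i ^ φ (m + N)) (fun i => v i ^ φ m) i).trans_lt
      (hm (m + N) (Nat.le_add_right m N))
  have h2 : v i ^ φ (m + N) - v i ^ φ m = v i ^ φ m * (v i ^ (φ (m + N) - φ m) - 1) := by
    rw [mul_sub, ← pow_add, mul_one, Nat.add_sub_cancel' (hφ.monotone (Nat.le_add_right m N))]
  rw [dist_eq_norm, h2, norm_mul, norm_pow, hv i, one_pow, one_mul] at h1
  have h3 := (Complex.abs_re_le_norm _).trans h1.le
  rw [Complex.sub_re, Complex.one_re, abs_le] at h3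
  linarith [h3.1]

/-- For suitable arbitrarily large `n` every eigenvalue satisfies `Re (c ^ n) ≥ ‖c‖ ^ n / 2`, so all
terms of the power sum have nonnegative real part and the largest one survives. The alternative `R =
0` serves the case without eigenvalues. -/
theorem frequently_pow_le_norm_trace {r : ℕ} (B : Matrix (Fin r) (Fin r) ℂ) :
    ∃ R : ℝ, 0 ≤ R ∧ spectralRadius ℂ B ≤ ENNReal.ofReal R ∧
      ∃ᶠ n in atTop, R ^ n / 2 ≤ ‖(B ^ n).trace‖ ∨ R = 0 := by
  obtain ⟨s, d, hd, hs, htr⟩ := exists_trace_pow_eq_sum (Matrix.toLin' B)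
  rw [Matrix.spectrum_toLin'] at hs
  have htr' : ∀ n : ℕ, (B ^ n).trace = ∑ c ∈ s, (d c : ℂ) * c ^ n := by
    intro n
    rw [← htr, ← Matrix.trace_toLin'_eq, Matrix.toLin'_pow]
  rcases s.eq_empty_or_nonempty with rfl | hne
  · refine ⟨0, le_rfl, ?_, Frequently.of_forall fun n => Or.inr rfl⟩
    rw [spectralRadius]
    refine iSup₂_le fun c hc => ?_
    simpa using hs hc
  obtain ⟨c₀, hc₀, hmax⟩ := s.exists_max_image (fun c => ‖c‖) hne
  refine ⟨‖c₀‖, norm_nonneg _, iSup₂_le fun c hc => ?_, ?_⟩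
  · rw [← ENNReal.ofReal_coe_nnreal, coe_nnnorm]
    exact ENNReal.ofReal_le_ofReal (hmax c (hs hc))
  rw [frequently_atTop]
  intro N
  -- Only nonzero eigenvalues have a phase; asking for `N + 1` makes `n` positive, so that the
  -- eigenvalue zero contributes nothing.
  obtain ⟨n, hn, hre⟩ := exists_pow_re_ge
    (fun c : {c : s // (c : ℂ) ≠ 0} => (c : ℂ) / (‖(c : ℂ)‖ : ℂ)) (fun c => by
      rw [norm_div, Complex.norm_real, norm_norm, div_self (norm_ne_zero_iff.2 c.2)]) (N + 1)
  refine ⟨n, by omega, Or.inl ?_⟩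
  have hterm : ∀ c ∈ s, ‖c‖ ^ n / 2 ≤ (c ^ n).re := by
    intro c hc
    by_cases h0 : c = 0
    · subst h0
      simp [show n ≠ 0 by omega]
    · have h1 := hre ⟨⟨c, hc⟩, h0⟩
      have h2 : c ^ n = ((‖c‖ ^ n : ℝ) : ℂ) * (c / (‖c‖ : ℂ)) ^ n := by
        push_cast
        rw [← mul_pow, mul_div_cancel₀]
        simpa using h0
      rw [h2, Complex.re_ofReal_mul]
      have h3 : 0 ≤ ‖c‖ ^ n := by positivity
      nlinarith [h1]
  have hnn : ∀ c ∈ s, 0 ≤ (c ^ n).re := fun c hc => le_trans (by positivity) (hterm c hc)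
  calc ‖c₀‖ ^ n / 2 ≤ (c₀ ^ n).re := hterm c₀ hc₀
    _ ≤ d c₀ * (c₀ ^ n).re :=
        le_mul_of_one_le_left (hnn c₀ hc₀) (by exact_mod_cast hd c₀ hc₀)
    _ ≤ ∑ c ∈ s, d c * (c ^ n).re :=
        Finset.single_le_sum (f := fun c => d c * (c ^ n).re)
          (fun c hc => mul_nonneg (Nat.cast_nonneg _) (hnn c hc)) hc₀
    _ = ((B ^ n).trace).re := by
        rw [htr', Complex.re_sum]
        refine Finset.sum_congr rfl fun c _ => ?_
        rw [← Complex.ofReal_natCast, Complex.re_ofReal_mul]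
    _ ≤ ‖(B ^ n).trace‖ := Complex.re_le_norm _

/-- A sequence that bounds the traces of the powers of an integer matrix has exponential growth
rate at least the logarithm of the spectral radius. -/
theorem log_matrixSpectralRadius_le_limsup {r : ℕ} (B : Matrix (Fin r) (Fin r) ℤ)
    (t : ℕ → ENNReal) (ht : ∀ n, 1 ≤ n → (((B ^ (n + 1)).trace.natAbs : ℕ) : ENNReal) ≤ t n) :
    ENNReal.log (matrixSpectralRadius B)
      ≤ limsup (fun n : ℕ => ENNReal.log (t n) / ((n + 1 : ℕ) : EReal)) atTop := by
  obtain ⟨R, hR0, hR, hfreq⟩ := frequently_pow_le_norm_trace (B.map (Int.cast : ℤ → ℂ))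
  refine (ENNReal.log_monotone hR).trans ?_
  rcases hR0.eq_or_lt with rfl | hpos
  · simp
  rw [ENNReal.log_ofReal_of_pos hpos]
  refine le_of_forall_lt fun c hc => ?_
  obtain ⟨c', hcc', hc'⟩ := exists_between hc
  refine hcc'.trans_le (le_limsup_of_frequently_le ?_)
  induction c' with
  | bot => exact Frequently.of_forall fun n => bot_le
  | top => exact absurd hc' (by simp)
  | coe c' =>
  have hc'' : c' < Real.log R := by exact_mod_cast hc'
  -- This is `log (R ^ n / 2) / n`: the factor `1 / 2` is invisible in the limit.
  have hlim : Tendsto (fun n : ℕ => Real.log R - Real.log 2 / n) atTop (nhds (Real.log R)) := by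
    simpa using tendsto_const_nhds.sub (tendsto_const_div_atTop_nhds_zero_nat (Real.log 2))
  have hev := hlim.eventually (lt_mem_nhds hc'')
  -- Exponents start at `2` because `t n` is compared with the power `n + 1` only for `n ≥ 1`.
  have hfreq' := (hfreq.and_eventually (hev.and (eventually_ge_atTop 2)))
  rw [frequently_atTop] at hfreq' ⊢
  intro N
  obtain ⟨n, hnN, hn, hlog, hn2⟩ := hfreq' (N + 1)
  obtain ⟨n, rfl⟩ : ∃ m, n = m + 1 := ⟨n - 1, by omega⟩
  refine ⟨n, by omega, ?_⟩
  have h1 : R ^ (n + 1) / 2 ≤ ((B ^ (n + 1)).trace.natAbs : ℝ) := by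
    rcases hn with hn | hn
    · refine hn.trans_eq ?_
      have hmap : (B.map (Int.cast : ℤ → ℂ)) ^ (n + 1) = (B ^ (n + 1)).map (Int.cast : ℤ → ℂ) :=
        (Matrix.map_pow B (Int.castRingHom ℂ) (n + 1)).symm
      have htr : ((B ^ (n + 1)).map (Int.cast : ℤ → ℂ)).trace = ((B ^ (n + 1)).trace : ℂ) := by
        simp [Matrix.trace]
      rw [hmap, htr, Complex.norm_intCast, Nat.cast_natAbs, Int.cast_abs]
    · exact absurd hn hpos.ne'
  have h2 : ENNReal.ofReal (R ^ (n + 1) / 2) ≤ t n := by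
    refine le_trans ?_ (ht n (by omega))
    rw [← ENNReal.ofReal_natCast]
    exact ENNReal.ofReal_le_ofReal h1
  have h3 : ((Real.log (R ^ (n + 1) / 2) : ℝ) : EReal) ≤ ENNReal.log (t n) := by
    rw [← ENNReal.log_ofReal_of_pos (by positivity)]
    exact ENNReal.log_monotone h2
  have h4 : (((n + 1 : ℕ) : ℝ) : EReal) = ((n + 1 : ℕ) : EReal) := by norm_cast
  refine le_trans ?_ (EReal.div_le_div_right_of_nonneg (by positivity) h3)
  rw [← h4, ← EReal.coe_div, EReal.coe_le_coe_iff]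
  refine hlog.le.trans (le_of_eq ?_)
  rw [Real.log_div (by positivity) two_ne_zero, Real.log_pow]
  field_simp

end Growth

/-! ### The entropy of a perfect complex -/

section Entropy

open scoped ModuleCat

variable {k A : Type u} [Field k] [Ring A] [Algebra k A] {r : ℕ} {e : Fin r → A}

theorem cartanMatrix_congr {X Y : Bimod k A} (φ : X ≅ Y) : cartanMatrix e X = cartanMatrix e Y := by
  ext i j
  rw [cartanMatrix_apply, cartanMatrix_apply,
    ((cutFunctor k (envIdempotent k e (j, i))).mapIso φ).toLinearEquiv.finrank_eq]

/-- The Cartan matrix of a complex depends only on its quasi-isomorphism class. -/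
theorem cartanMatrixComplex_congr {K L : CochainComplex (Bimod k A) ℤ} (f : K ⟶ L) [QuasiIso f] :
    cartanMatrixComplex e K = cartanMatrixComplex e L :=
  finsum_congr fun l => by rw [cartanMatrix_congr (isoOfQuasiIsoAt f l)]

variable [FiniteDimensional k A] {π : Env k A →ₐ[k] (Fin r × Fin r → k)}

/-- The Cartan matrix of a bounded complex may be computed from its terms. -/
theorem cartanMatrixComplex_eq_eulerMatrix (h : IsSplitBasic (envIdempotent k e) π)
    {P : CochainComplex (Bimod k A) ℤ} (hP : IsBoundedComplex P)
    (hPfin : ∀ i, Module.Finite (Env k A) (P.X i)) :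
    cartanMatrixComplex e P = eulerMatrix e P := by
  have hsupp : ∀ l ∉ Set.Finite.toFinset hP, Limits.IsZero (P.homology l) := fun l hl =>
    ShortComplex.isZero_homology_of_isZero_X₂ _ (hP.isZero l hl)
  ext i j
  set F := cutFunctor k (envIdempotent k e (j, i)) with hF
  -- Cutting by an idempotent commutes with cohomology, so each entry is an Euler characteristic of
  -- a complex of vector spaces.
  have : F.PreservesHomology := cutFunctor_preservesHomology (h.complete.idem (j, i))
  have h1 := altSum_finrank_homology ((F.mapHomologicalComplex (ComplexShape.up ℤ)).obj P)
    (fun l => finiteDimensional_cutFunctor (envIdempotent k e (j, i)) (P.X l)) (hP.map F)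
  have h2 : ∀ l, cartanMatrix e (P.homology l) i j = Module.finrank k
      (((F.mapHomologicalComplex (ComplexShape.up ℤ)).obj P).homology l) := fun l => by
    rw [cartanMatrix_apply]
    exact congrArg Nat.cast ((P.sc l).mapHomologyIso F).toLinearEquiv.finrank_eq.symm
  refine Eq.trans ?_ h1
  rw [cartanMatrixComplex, finsum_eq_sum_of_support_subset (s := Set.Finite.toFinset hP),
    altSum_eq_sum (Set.Finite.toFinset hP), Matrix.sum_apply]
  · exact Finset.sum_congr rfl fun l _ => by rw [Matrix.smul_apply, h2, smul_eq_mul]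
  · intro l hl
    rw [← h2, cartanMatrix_eq_zero (hsupp l hl)]
    rfl
  · intro l hl
    by_contra hl'
    exact hl (by simp [cartanMatrix_eq_zero (hsupp l hl')])

/-- The Euler matrices of the tensor powers of a perfect complex. -/
theorem eulerMatrix_tensorPowSucc (h : IsSplitBasic (envIdempotent k e) π)
    (hC : IsUnit (cartanMatrixAlgebra k e).det) {P : CochainComplex (Bimod k A) ℤ}
    (hP : IsBoundedComplex P) (hPfin : ∀ i, Module.Finite (Env k A) (P.X i))
    (hPproj : ∀ i, Module.Projective (Env k A) (P.X i)) (n : ℕ) :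
    IsBoundedComplex (tensorPowSucc P n) ∧
    (∀ i, FiniteDimensional k ((tensorPowSucc P n).X i)) ∧
    eulerMatrix e (tensorPowSucc P n)
      = (eulerMatrix e P * (cartanMatrixAlgebra k e)⁻¹) ^ n * eulerMatrix e P := by
  induction n with
  | zero => exact ⟨hP, fun i => finiteDimensional_moduleCat (P.X i), by simp [tensorPowSucc]⟩
  | succ n ih =>
    obtain ⟨h1, h2, h3⟩ := ih
    obtain ⟨h4, h5, -, -⟩ := eulerMatrix_tensorComplex h hC h1 h2 hP hPfin hPproj
    refine ⟨h1.tensorComplex hP, h4, h5.trans ?_⟩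
    rw [h3, pow_succ', Matrix.mul_assoc _ (_ ^ n)]

/-- The trace of a power of the Coxeter matrix bounds the total Hochschild homology of the
corresponding tensor power. -/
theorem natAbs_trace_le_tdim (h : IsSplitBasic (envIdempotent k e) π)
    (hC : IsUnit (cartanMatrixAlgebra k e).det) {P : CochainComplex (Bimod k A) ℤ}
    (hP : IsBoundedComplex P) (hPfin : ∀ i, Module.Finite (Env k A) (P.X i))
    (hPproj : ∀ i, Module.Projective (Env k A) (P.X i)) (n : ℕ) :
    ((((eulerMatrix e P * (cartanMatrixAlgebra k e)⁻¹) ^ (n + 2)).trace.natAbs : ℕ) : ENNReal)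
      ≤ tdim (envTensorComplex (tensorPowSucc P (n + 1))) := by
  -- The trace formula concerns a product `K ⊗ P`; taking for `K` the power with `n + 1` factors
  -- gives `n + 2` factors in all.
  obtain ⟨h1, h2, h3⟩ := eulerMatrix_tensorPowSucc h hC hP hPfin hPproj n
  obtain ⟨-, -, h4, h5⟩ := eulerMatrix_tensorComplex h hC h1 h2 hP hPfin hPproj
  refine le_trans (le_of_eq ?_)
    (natAbs_altSum_le_tdim _ h4 ((h1.tensorComplex hP).map (envTensorFunctor k A)))
  refine (congrArg (fun z : ℤ => ((z.natAbs : ℕ) : ENNReal)) (h5.trans ?_)).symm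
  rw [h3, pow_succ, pow_succ']
  simp only [Matrix.mul_assoc]

end Entropy

end HHEntropy

end

theorem theorem5 (k A : Type u) [Field k] [Ring A] [Algebra k A] [FiniteDimensional k A]
    (helem : HHEntropy.IsElementary k A) (hgl : HHEntropy.FiniteGlobalDimension A)
    {r : ℕ} (e : Fin r → A) (hcomplete : CompleteOrthogonalIdempotents e)
    (hprim : ∀ i, HHEntropy.IsPrimitiveIdempotent (e i))
    (M : CochainComplex (HHEntropy.Bimod k A) ℤ) (R : HHEntropy.PerfectResolution M) :
    IsUnit (HHEntropy.cartanMatrixAlgebra k e).det ∧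
      ENNReal.log (HHEntropy.matrixSpectralRadius (HHEntropy.dualCoxeterMatrix e M))
        ≤ R.hhEntropy := by
  obtain ⟨π, hπ, hker⟩ := helem.exists_algHom e hcomplete hprim
  have hC := HHEntropy.isUnit_det_cartanMatrixAlgebra hgl
    (HHEntropy.isSplitBasic_op hcomplete hπ hker)
  have henv := HHEntropy.isSplitBasic_env hcomplete hπ hker
  -- The case of one factor is left out, which does not affect the limit superior.
  refine ⟨hC, HHEntropy.log_matrixSpectralRadius_le_limsup _ _ fun n hn => ?_⟩
  obtain ⟨m, rfl⟩ := Nat.exists_eq_add_of_le' hn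
  have := R.quasiIso
  refine le_trans (le_of_eq ?_)
    (HHEntropy.natAbs_trace_le_tdim henv hC R.bounded R.finite R.projective m)
  rw [HHEntropy.dualCoxeterMatrix, ← HHEntropy.cartanMatrixComplex_congr R.π,
    HHEntropy.cartanMatrixComplex_eq_eulerMatrix henv R.bounded R.finite]
  -- The sign in the dual Coxeter matrix changes the trace of a power by at most a sign.
  rcases Nat.even_or_odd (m + 1 + 1) with h | h
  · rw [h.neg_pow]
  · rw [h.neg_pow, Matrix.trace_neg, Int.natAbs_neg]
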